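/- **Notation.** Let $\mathbf x=(x_1,x_2,\dots)$, $\mathbf t=(t_1,t_2,\dots)$. For $f\in\mathbb Z[\mathbf t][\mathbf x]$ and $i\ge 1$ put $$R_i^-f=f(x_1,\dots,x_{i-1},t_i,x_i,x_{i+1},\dots;\mathbf t),\qquad R_i^+f=f(x_1,\dots,x_{i-1},x_i,t_i,x_{i+1},\dots;\mathbf t),\qquad E_if=\frac{R_i^+f-R_i^-f}{x_i-t_i}.$$ $\mathrm{EQSym}_n$ is the set of $f\in\mathbb Z[\mathbf t][x_1,\dots,x_n]$ with $R_i^+f=R_i^-f$ for $1\le i<n$. For a permutation $\sigma$ of $\{1,2,\dots\}$ fixing all but finitely many elements, $\mathrm{ev}_\sigma f=f(t_{\sigma(1)},t_{\sigma(2)},\dots;\mathbf t)\in\mathbb Z[\mathbf t]$. A set partition of $[n]=\{1,\dots,n\}$ is noncrossing if there are no distinct blocks $A,B$ with $a,b\in A$, $c,d\in B$ and $a<c<b<d$. $\mathrm{NC}_n\subset S_n$ is the set of noncrossing permutations, i.e. the products, over the blocks $\{a_p>\dots>a_1\}$ of a noncrossing partition of $[n]$, of the backwards cycles $(a_p\,a_{p-1}\cdots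 a_1)$. An indexed forest $F=(T_1,T_2,\dots)$ is a sequence of finite plane binary trees (each node has $0$ or $2$ children), all but finitely many of which are a single leaf; its leaves are labelled $1,2,\dots$ from left to right, and $\emptyset$ is the forest of single leaves. For an internal node $v$ let $\rho(v)$ be the leaf reached from $v$ along left edges. The code of $F$ is $c(F)=(c_1,c_2,\dots)$ with $c_i=|\{v:\rho(v)=i\}|$. Let $\mathrm{qdes}(F)=\{\rho(v): \text{both children of } v\text{ are leaves}\}$ and, for $i\in\mathrm{qdes}(F)$, let $F/i$ be $F$ with the node $v$ with leaf children and $\rho(v)=i$ replaced by a leaf. The double forest polynomials are the family of homogeneous polynomials $P_F(\mathbf x;\mathbf t)\in\mathbb Z[\mathbf t][\mathbf x]$, indexed by the indexed forests, determined by $$P_F(\mathbf t;\mathbf t)=\begin{cases}1&F=\emptyset\\0&F\neq\emptyset\end{cases}\qquad\text{and}\qquad E_iP_F=\begin{cases}P_{F/i}(\mathbf x;t_1,\dots,t_{i-1},t_{i+1},\dots)&i\in\mathrm{qdes}(F)\\0&i\notin\mathrm{qdes}(F)\end{cases}\quad(i\ge1).$$ For a padded composition $c=(0^{n-\ell},a_1,\dots,a_\ell)$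 of length $n$ (all $a_j>0$), the double fundamental quasisymmetric polynomial is $\mathfrak F_c=P_{F_c}$, where $F_c$ is the indexed forest with code $(c,0,0,\dots)$. It is $1$ if $c=0^n$; the nonconstant ones are those with $c\ne 0^n$. **Theorem.** Let $n\ge0$. 1. If $f\in\mathrm{EQSym}_n$ and $\sigma\in\mathrm{NC}_n$, then $\mathrm{ev}_\sigma f=\mathrm{ev}_{\mathrm{id}}f$. 2. The double forest polynomials are well defined (there is exactly one family $(P_F)$ as above), and if $c\neq 0^n$ is a padded composition of length $n$, then $\mathrm{ev}_\sigma\mathfrak F_c=0$ for all $\sigma\in\mathrm{NC}_n$. That is, every nonconstant double fundamental quasisymmetric polynomial vanishes at all noncrossing permutations. 3. $\mathrm{NC}_n$ is the class of the identity under the equivalence relation $\sim_{\mathrm{NC}}$ on $S_n$ generated by $\sigma\sim_{\mathrm{NC}}\sigma s_i$ whenever $1\le i<n$ and $i\in\{\sigma(i),\sigma(i+1)\}$, where $s_i=(i,i+1)$. -/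

import Mathlib

/-! Indices start at `0`: the variables `x 0, x 1, …` and `t 0, t 1, …` are usually written `x₁, x₂, …` and
`t₁, t₂, …`, `[n]` is `{0, …, n - 1}`, and leaves, codes and permutations are
shifted by one in the same way. -/

namespace EQSymNC

/-! ### Polynomials in two sets of variables -/

/-- The ring `ℤ[t][x]` of polynomials in the variables `x 0, x 1, …` and `t 0, t 1, …`. -/
abbrev Poly : Type := MvPolynomial (ℕ ⊕ ℕ) ℤ

noncomputable def x (i : ℕ) : Poly := MvPolynomial.X (Sum.inl i)

noncomputable def t (i : ℕ) : Poly := MvPolynomial.X (Sum.inr i)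

/-- `f(x₀, …, x_{i-1}, t_i, x_i, x_{i+1}, …; t)`: put `t_i` in position `i` and move the later
`x`-variables one position to the right. -/
noncomputable def Rminus (i : ℕ) : Poly →ₐ[ℤ] Poly :=
  MvPolynomial.aeval (Sum.elim
    (fun j => if j < i then x j else if j = i then t i else x (j - 1)) t)

/-- `f(x₀, …, x_{i-1}, x_i, t_i, x_{i+1}, …; t)`: put `t_i` in position `i + 1` and move the later
`x`-variables one position to the right. -/
noncomputable def Rplus (i : ℕ) : Poly →ₐ[ℤ] Poly :=
  MvPolynomial.aeval (Sum.elim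
    (fun j => if j < i + 1 then x j else if j = i + 1 then t i else x (j - 1)) t)

/-- The equivariantly quasisymmetric polynomials in `ℤ[t][x₀, …, x_{n-1}]`. -/
def EQSym (n : ℕ) : Set Poly :=
  {f | (∀ j, Sum.inl j ∈ f.vars → j < n) ∧ ∀ i, i + 1 < n → Rplus i f = Rminus i f}

/-- The evaluation `f(x; t) ↦ f(t_{σ(0)}, t_{σ(1)}, …; t)` in `ℤ[t]`. -/
noncomputable def ev (σ : Equiv.Perm ℕ) : Poly →ₐ[ℤ] MvPolynomial ℕ ℤ :=
  MvPolynomial.aeval (Sum.elim (fun j => MvPolynomial.X (σ j)) MvPolynomial.X)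

/-- The substitution `f(x; t) ↦ f(x; t₀, …, t_{i-1}, t_{i+1}, …)`. -/
noncomputable def omitT (i : ℕ) : Poly →ₐ[ℤ] Poly :=
  MvPolynomial.aeval (Sum.elim x (fun j => if j < i then t j else t (j + 1)))

/-- `g` is the equivariant quasisymmetric divided difference
`(R_i⁺ f - R_i⁻ f) / (x_i - t_i)` of `f` (the quotient is unique, as `Poly` is a domain). -/
def IsDividedDifference (i : ℕ) (f g : Poly) : Prop :=
  Rplus i f - Rminus i f = (x i - t i) * g

/-! ### Noncrossing permutations -/

/-- No two distinct blocks contain `a, b` and `c, d`, respectively, with `a < c < b < d`. -/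
def IsNoncrossing {n : ℕ} (P : Finpartition (Finset.range n)) : Prop :=
  ∀ A ∈ P.parts, ∀ B ∈ P.parts, A ≠ B →
    ∀ a ∈ A, ∀ b ∈ A, ∀ c ∈ B, ∀ d ∈ B, ¬ (a < c ∧ c < b ∧ b < d)

/-- On the block `B = {a_p > ⋯ > a_1}` the permutation is the backwards cycle
`a_p ↦ a_{p-1} ↦ ⋯ ↦ a_1 ↦ a_p`: an element goes to the next smaller element of `B`, and the
smallest element goes to the largest one. -/
def IsBackwardsCycleOn (σ : Equiv.Perm ℕ) (B : Finset ℕ) : Prop :=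
  ∀ a ∈ B, IsGreatest {b | b ∈ B ∧ b < a} (σ a) ∨
    (IsLeast (B : Set ℕ) a ∧ IsGreatest (B : Set ℕ) (σ a))

/-- The noncrossing permutations: the products of the backwards cycles on the blocks of a
noncrossing partition of `{0, …, n - 1}`, with `S_n` seen as the group of all permutations of `ℕ`
that fix every `i ≥ n`. -/
def NC (n : ℕ) : Set (Equiv.Perm ℕ) :=
  {σ | (∀ i, n ≤ i → σ i = i) ∧ ∃ P : Finpartition (Finset.range n),
    IsNoncrossing P ∧ ∀ B ∈ P.parts, IsBackwardsCycleOn σ B}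

/-- The generating relations `σ ∼ σ s_i` for `i ∈ {σ(i), σ(i+1)}`. -/
def NCStep (n : ℕ) (σ τ : Equiv.Perm ℕ) : Prop :=
  ∃ i, i + 1 < n ∧ (σ i = i ∨ σ (i + 1) = i) ∧ τ = σ * Equiv.swap i (i + 1)

/-! ### Indexed forests

A binary plane tree is a `BinaryTree Unit`, where `BinaryTree.nil` is the trivial tree (a single leaf). In the
functions on trees below, `a` is the label of the leftmost leaf of the tree. -/

/-- The number of internal nodes `v` with `ρ(v) = i`, where `ρ(v)` is the label of the leaf that is
reached from `v` along left edges. -/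
def treeCode : BinaryTree Unit → ℕ → ℕ → ℕ
  | .nil, _, _ => 0
  | .node _ l r, a, i =>
      (if i = a then 1 else 0) + treeCode l a i + treeCode r (a + l.numLeaves) i

/-- The labels `ρ(v)` of the terminal nodes `v` (both children of `v` are leaves). -/
def treeQDes : BinaryTree Unit → ℕ → Set ℕ
  | .nil, _ => ∅
  | .node _ .nil .nil, a => {a}
  | .node _ l r, a => treeQDes l a ∪ treeQDes r (a + l.numLeaves)

/-- Delete the terminal node `v` with `ρ(v) = i`, if there is one: it becomes a leaf. -/
def treeTrim : BinaryTree Unit → ℕ → ℕ → BinaryTree Unit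
  | .nil, _, _ => .nil
  | .node _ .nil .nil, a, i => if i = a then .nil else .node () .nil .nil
  | .node _ l r, a, i => .node () (treeTrim l a i) (treeTrim r (a + l.numLeaves) i)

/-- An indexed forest: a sequence of binary trees, all but finitely many of them trivial. -/
@[ext]
structure IndexedForest where
  tree : ℕ → BinaryTree Unit
  finite : {j | tree j ≠ .nil}.Finite

namespace IndexedForest

/-- The forest all of whose trees are trivial. -/
def empty : IndexedForest := ⟨fun _ => .nil, by simp⟩

/-- The leaves of a forest are labelled `0, 1, 2, …` from left to right; this is the label of the
leftmost leaf of the tree with index `j`. -/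
def firstLeaf (F : IndexedForest) (j : ℕ) : ℕ := ∑ k ∈ Finset.range j, (F.tree k).numLeaves

/-- The code of a forest. Since `j ≤ F.firstLeaf j`, the trees with index `j > i` do not
contribute to the entry at `i`. -/
def code (F : IndexedForest) (i : ℕ) : ℕ :=
  ∑ j ∈ Finset.range (i + 1), treeCode (F.tree j) (F.firstLeaf j) i

/-- The labels `ρ(v)` of the terminal nodes `v` of the forest. -/
def qdes (F : IndexedForest) : Set ℕ := {i | ∃ j, i ∈ treeQDes (F.tree j) (F.firstLeaf j)}

/-- The trimmed forest `F / i`. -/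
def trim (F : IndexedForest) (i : ℕ) : IndexedForest where
  tree j := treeTrim (F.tree j) (F.firstLeaf j) i
  finite := F.finite.subset fun j hj h => hj (by simp [h, treeTrim])

end IndexedForest

/-! ### Double forest polynomials and double fundamental quasisymmetric polynomials -/

/-- The conditions that define the double forest polynomials: homogeneity, the normalization
`P_F(t; t) = δ_{F, ∅}`, and the recursion `E_i P_F = P_{F / i}(x; t₀, …, t_{i-1}, t_{i+1}, …)` if
`i ∈ qdes F`, `E_i P_F = 0` otherwise. -/
structure IsDoubleForestFamily (P : IndexedForest → Poly) : Prop where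
  homogeneous : ∀ F, ∃ d, (P F).IsHomogeneous d
  ev_empty : ev 1 (P .empty) = 1
  ev_of_ne : ∀ F, F ≠ .empty → ev 1 (P F) = 0
  trim_mem : ∀ F, ∀ i ∈ F.qdes, IsDividedDifference i (P F) (omitT i (P (F.trim i)))
  trim_notMem : ∀ F, ∀ i ∉ F.qdes, IsDividedDifference i (P F) 0

/-- Padded compositions `(0, …, 0, a_1, …, a_l)` of length `n`, with all `a_i > 0`; they are
extended by zeros to infinite sequences. -/
def IsPadded (n : ℕ) (c : ℕ → ℕ) : Prop :=
  ∃ k ≤ n, (∀ i < k, c i = 0) ∧ (∀ i, k ≤ i → i < n → 0 < c i) ∧ ∀ i, n ≤ i → c i = 0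

/-! ### Every finitely supported sequence is the code of a forest -/

theorem treeCode_of_lt (T : BinaryTree Unit) : ∀ a i, i < a → treeCode T a i = 0 := by
  induction T with
  | nil => intros; rfl
  | node _ l r hl hr =>
    intro a i h
    simp [treeCode, hl a i h, hr (a + l.numLeaves) i (by omega), h.ne]

theorem treeCode_succ (T : BinaryTree Unit) :
    ∀ a i, treeCode T (a + 1) (i + 1) = treeCode T a i := by
  induction T with
  | nil => intros; rfl
  | node _ l r hl hr =>
    intro a i
    have h := hr (a + l.numLeaves) i
    rw [show a + l.numLeaves + 1 = a + 1 + l.numLeaves by omega] at h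
    simp [treeCode, hl a i, h]

theorem IndexedForest.le_firstLeaf (F : IndexedForest) (j : ℕ) : j ≤ F.firstLeaf j := by
  have := Finset.card_nsmul_le_sum (Finset.range j) (fun k => (F.tree k).numLeaves) 1
    (fun k _ => (F.tree k).numLeaves_pos)
  simpa [IndexedForest.firstLeaf] using this

/-- A left path with `k` nodes whose right subtrees are `T 0, …, T (k - 1)` from left to right. -/
def spine (T : ℕ → BinaryTree Unit) : ℕ → BinaryTree Unit
  | 0 => .nil
  | k + 1 => .node () (spine T k) (T k)

theorem numLeaves_spine (F : IndexedForest) (k : ℕ) :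
    (spine F.tree k).numLeaves = F.firstLeaf k + 1 := by
  induction k with
  | zero => rfl
  | succ k ih =>
    simp only [IndexedForest.firstLeaf, Finset.sum_range_succ] at ih ⊢
    simp only [spine, BinaryTree.numLeaves]
    omega

theorem treeCode_spine_zero (F : IndexedForest) (k : ℕ) : treeCode (spine F.tree k) 0 0 = k := by
  induction k with
  | zero => rfl
  | succ k ih =>
    rw [spine, treeCode, ih, numLeaves_spine, treeCode_of_lt _ _ _ (by omega)]
    simp [add_comm]

theorem treeCode_spine_succ (F : IndexedForest) (k i : ℕ) :
    treeCode (spine F.tree k) 0 (i + 1) =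
      ∑ j ∈ Finset.range k, treeCode (F.tree j) (F.firstLeaf j) i := by
  induction k with
  | zero => rfl
  | succ k ih =>
    rw [spine, treeCode, ih, numLeaves_spine, Finset.sum_range_succ, zero_add, treeCode_succ]
    simp

/-- Join the first `k` trees of `F` by a left path that starts at a new first leaf. -/
def IndexedForest.cons (k : ℕ) (F : IndexedForest) : IndexedForest where
  tree j := match j with
    | 0 => spine F.tree k
    | j + 1 => F.tree (k + j)
  finite := by
    obtain ⟨N, hN⟩ := F.finite.bddAbove
    refine (Set.finite_Iic (N + 1)).subset fun j hj => ?_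
    cases j with
    | zero => simp
    | succ j => have := hN (show k + j ∈ {j | F.tree j ≠ .nil} from hj); simp; omega

theorem IndexedForest.firstLeaf_cons (k : ℕ) (F : IndexedForest) (j : ℕ) :
    (F.cons k).firstLeaf (j + 1) = F.firstLeaf (k + j) + 1 := by
  induction j with
  | zero => simpa [IndexedForest.firstLeaf, IndexedForest.cons] using numLeaves_spine F k
  | succ j ih =>
    have h1 : (F.cons k).firstLeaf (j + 1 + 1) =
      (F.cons k).firstLeaf (j + 1) + (F.tree (k + j)).numLeaves := Finset.sum_range_succ _ _
    have h2 : F.firstLeaf (k + (j + 1)) = F.firstLeaf (k + j) + (F.tree (k + j)).numLeaves :=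
      Finset.sum_range_succ _ _
    omega

theorem IndexedForest.code_cons_zero (k : ℕ) (F : IndexedForest) : (F.cons k).code 0 = k := by
  simpa [IndexedForest.code, IndexedForest.cons, IndexedForest.firstLeaf] using
    treeCode_spine_zero F k

theorem IndexedForest.code_cons_succ (k : ℕ) (F : IndexedForest) (i : ℕ) :
    (F.cons k).code (i + 1) = F.code i := by
  have h : ∀ j, treeCode ((F.cons k).tree (j + 1)) ((F.cons k).firstLeaf (j + 1)) (i + 1) =
      treeCode (F.tree (k + j)) (F.firstLeaf (k + j)) i := fun j => by
    rw [IndexedForest.firstLeaf_cons, treeCode_succ]; rfl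
  rw [IndexedForest.code, Finset.sum_range_succ', Finset.sum_congr rfl (fun j _ => h j)]
  have h0 : treeCode ((F.cons k).tree 0) ((F.cons k).firstLeaf 0) (i + 1) = _ :=
    treeCode_spine_succ F k i
  rw [h0, add_comm, ← Finset.sum_range_add, IndexedForest.code]
  symm
  refine Finset.sum_subset (fun j hj => ?_) (fun j _ hj => ?_)
  · simp at hj ⊢; omega
  · refine treeCode_of_lt _ _ _ (lt_of_lt_of_le ?_ (F.le_firstLeaf j))
    simp at hj; omega

theorem IndexedForest.exists_code_eq (n : ℕ) : ∀ c : ℕ → ℕ, (∀ i, n ≤ i → c i = 0) →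
    ∃ F : IndexedForest, F.code = c := by
  induction n with
  | zero =>
    intro c hc
    refine ⟨.empty, funext fun i => ?_⟩
    simp [IndexedForest.code, IndexedForest.empty, treeCode, hc i]
  | succ n ih =>
    intro c hc
    obtain ⟨F, hF⟩ := ih (fun i => c (i + 1)) (fun i hi => hc _ (by omega))
    refine ⟨F.cons (c 0), funext fun i => ?_⟩
    cases i with
    | zero => exact F.code_cons_zero _
    | succ i => rw [F.code_cons_succ, hF]

end EQSymNC


namespace EQSymNC

/-! If `σ i = i`, then `ev σ f` and `ev (σ * swap i (i + 1)) f` are the same specialization of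
`Rminus i f` and of `Rplus i f`, so they agree for equivariantly quasisymmetric `f`. Such a step
moves the singleton block `{i}` into the block of `i + 1`, or splits it off again, and these moves
connect all noncrossing permutations.

A family of polynomials satisfying the commutation relations of divided differences can be
integrated by induction on its degree: up to terms of lower degree all parameters `t i` may be taken
equal, and then an explicit telescoping sum is an antiderivative. The double forest polynomials are
constructed in this way from those of the trimmed forests. They are unique because a polynomial
whose divided differences all vanish does not involve the `x`-variables. -/

open Equiv (Perm swap)

/-! ### Moves between noncrossing permutations -/

section CyclicPred

variable {α : Type*} [LinearOrder α]

/-- The element `b` is the image of `a` under the backwards cycle on `S`. -/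
def IsCyclicPred (S : Set α) (a b : α) : Prop :=
  IsGreatest {c | c ∈ S ∧ c < a} b ∨ IsLeast S a ∧ IsGreatest S b

theorem IsCyclicPred.mem {S : Set α} {a b : α} (h : IsCyclicPred S a b) : b ∈ S :=
  h.elim (fun h => h.1.1) fun h => h.2.1

theorem IsCyclicPred.isLeast_isGreatest {S : Set α} {a b : α} (h : IsCyclicPred S a b)
    (hab : a ≤ b) : IsLeast S a ∧ IsGreatest S b :=
  h.resolve_left fun h => hab.not_gt h.1.2

theorem IsCyclicPred.eq_of_mem {S : Set α} {a b : α} (h : IsCyclicPred S a a) (hb : b ∈ S) :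
    b = a :=
  have ⟨h₁, h₂⟩ := h.isLeast_isGreatest le_rfl
  le_antisymm (h₂.2 hb) (h₁.2 hb)

theorem isCyclicPred_singleton {a b : α} : IsCyclicPred {a} a b ↔ b = a :=
  ⟨fun h => h.mem, fun h => h ▸ .inr ⟨isLeast_singleton, isGreatest_singleton⟩⟩

variable {S : Set α} {i j a b : α}

theorem isCyclicPred_insert_right (hij : i ⋖ j) :
    IsCyclicPred (insert i S) j b ↔ b = i := by
  have hi : IsGreatest {c | c ∈ insert i S ∧ c < j} i :=
    ⟨⟨Set.mem_insert i S, hij.lt⟩, fun c hc => hij.le_of_lt hc.2⟩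
  refine ⟨fun h => ?_, ?_⟩
  · exact (h.resolve_right fun h => (h.1.2 (Set.mem_insert i S)).not_gt hij.lt).unique hi
  · rintro rfl
    exact .inl hi

theorem isGreatest_insert_of_lt (hj : j ∈ S) (hij : i < j) :
    IsGreatest (insert i S) b ↔ IsGreatest S b := by
  simp only [IsGreatest, mem_upperBounds, Set.mem_insert_iff]
  grind

theorem isCyclicPred_insert_left (hij : i ⋖ j) (hi : i ∉ S) (hj : j ∈ S) :
    IsCyclicPred (insert i S) i b ↔ IsCyclicPred S j b := by
  have hlt : {c | c ∈ insert i S ∧ c < i} = {c | c ∈ S ∧ c < j} := by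
    ext c
    simp only [Set.mem_insert_iff, Set.mem_ofPred_eq]
    grind [(⟨hij.le_of_lt, fun h => h.trans_lt hij.lt⟩ : c < j ↔ c ≤ i)]
  have hleast : IsLeast (insert i S) i ↔ IsLeast S j := by
    simp only [IsLeast, mem_lowerBounds, Set.mem_insert_iff]
    grind [hij.lt, hij.ge_of_gt]
  rw [IsCyclicPred, hlt, hleast, isGreatest_insert_of_lt hj hij.lt, IsCyclicPred]

theorem isCyclicPred_insert_of_ne (hij : i ⋖ j) (hi : i ∉ S) (hj : j ∈ S) (ha : a ∈ S)
    (haj : a ≠ j) : IsCyclicPred (insert i S) a b ↔ IsCyclicPred S a b := by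
  have hai : a ≠ i := fun h => hi (h ▸ ha)
  have hleast : IsLeast (insert i S) a ↔ IsLeast S a := by
    simp only [IsLeast, mem_lowerBounds, Set.mem_insert_iff]
    grind [hij.lt, hij.le_of_lt (c := a)]
  have hlt : IsGreatest {c | c ∈ insert i S ∧ c < a} b ↔ IsGreatest {c | c ∈ S ∧ c < a} b := by
    rcases lt_or_ge i a with h | h
    · have hja : j < a := (hij.ge_of_gt h).lt_of_ne' haj
      rw [← isGreatest_insert_of_lt (S := {c | c ∈ S ∧ c < a}) ⟨hj, hja⟩ hij.lt]
      congr! 1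
      ext c
      simp only [Set.mem_insert_iff, Set.mem_ofPred_eq]
      grind
    · congr! 1
      ext c
      simp only [Set.mem_insert_iff, Set.mem_ofPred_eq]
      grind
  rw [IsCyclicPred, hlt, hleast, isGreatest_insert_of_lt hj hij.lt, IsCyclicPred]

end CyclicPred

section Setoid

variable {α : Type*}

/-- The equivalence relation in which `i` becomes a singleton class. -/
def isolate (r : Setoid α) (i : α) : Setoid α := r ⊓ .ker (· = i)

theorem isolate_iff {r : Setoid α} {i a b : α} :
    isolate r i a b ↔ r a b ∧ (a = i ↔ b = i) :=
  and_congr_right' eq_iff_iff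

variable [LinearOrder α]

/-- The equivalence relation `r` describes a noncrossing partition. -/
def NoncrossingRel (r : Setoid α) : Prop :=
  ∀ ⦃a c b d⦄, a < c → c < b → b < d → r a b → r c d → r a c

theorem NoncrossingRel.comap {r : Setoid α} (hr : NoncrossingRel r) {f : α → α}
    (hf : Monotone f) : NoncrossingRel (r.comap f) := by
  intro a c b d hac hcb hbd hab hcd
  rcases (hf hac.le).eq_or_lt with h | hac
  · exact r.comap_rel .. |>.2 (h ▸ r.refl _)
  rcases (hf hcb.le).eq_or_lt with h | hcb
  · exact r.comap_rel .. |>.2 (h ▸ hab)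
  rcases (hf hbd.le).eq_or_lt with h | hbd
  · exact r.trans hab (h ▸ r.symm hcd)
  exact hr hac hcb hbd hab hcd

/-- The permutation `σ` restricts to the backwards cycle on each class of `r`. -/
def HasBackwardsCycles (r : Setoid α) (σ : Perm α) : Prop :=
  ∀ a, IsCyclicPred {b | r a b} a (σ a)

/-- The equivalence relation in which `i` is moved to the class of `j`. -/
def moveTo (r : Setoid α) (i j : α) : Setoid α := r.comap (Function.update id i j)

theorem moveTo_iff {r : Setoid α} {i j a b : α} :
    moveTo r i j a b ↔ r (Function.update id i j a) (Function.update id i j b) := .rfl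

theorem monotone_update_id {i j : α} (hij : i ⋖ j) : Monotone (Function.update id i j) := by
  intro a b hab
  simp only [Function.update_apply, id]
  grind [hij.lt, hij.ge_of_gt (c := b)]

theorem NoncrossingRel.moveTo {r : Setoid α} (hr : NoncrossingRel r) {i j : α} (hij : i ⋖ j) :
    NoncrossingRel (moveTo r i j) :=
  hr.comap (monotone_update_id hij)

theorem setOf_moveTo_left (r : Setoid α) (i j : α) :
    {c | moveTo r i j i c} = insert i {c | r j c} := by
  ext c
  obtain rfl | hc := eq_or_ne c i
  · simp [moveTo_iff]
  · simp [moveTo_iff, hc]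

theorem setOf_moveTo_of_rel {r : Setoid α} {i j a : α} (ha : a ≠ i) (haj : r a j) :
    {c | moveTo r i j a c} = insert i {c | r a c} := by
  ext c
  obtain rfl | hc := eq_or_ne c i <;> simp [moveTo_iff, *]

theorem setOf_moveTo_of_not_rel {r : Setoid α} {i j a : α} (ha : ¬ r a i) (haj : ¬ r a j) :
    {c | moveTo r i j a c} = {c | r a c} := by
  have hai : a ≠ i := fun h => ha (h ▸ r.refl a)
  ext c
  obtain rfl | hc := eq_or_ne c i <;> simp [moveTo_iff, *]

theorem isCyclicPred_moveTo {r : Setoid α} {i j : α} (hij : i ⋖ j) (hi : ∀ b, r i b → b = i)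
    {a b : α} (hb : b = i ↔ a = j) :
    IsCyclicPred {c | moveTo r i j a c} a b ↔
      IsCyclicPred {c | r (swap i j a) c} (swap i j a) b := by
  have hi' {a : α} (ha : a ≠ i) : ¬ r a i := fun h => ha (hi a (r.symm h))
  obtain rfl | haj := eq_or_ne a j
  · have hS : {c | r i c} = {i} := Set.eq_singleton_iff_unique_mem.2 ⟨r.refl i, hi⟩
    rw [setOf_moveTo_of_rel hij.ne' (r.refl a), isCyclicPred_insert_right hij,
      Equiv.swap_apply_right, hS, isCyclicPred_singleton]
  obtain rfl | hai := eq_or_ne a i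
  · rw [setOf_moveTo_left, Equiv.swap_apply_left,
      isCyclicPred_insert_left (S := {c | r j c}) hij (hi' hij.ne') (r.refl j)]
  rw [Equiv.swap_apply_of_ne_of_ne hai haj]
  by_cases h : r a j
  · rw [setOf_moveTo_of_rel hai h,
      isCyclicPred_insert_of_ne (S := {c | r a c}) hij (hi' hai) h (r.refl a) haj]
  · rw [setOf_moveTo_of_not_rel (hi' hai) h]

theorem hasBackwardsCycles_moveTo {r : Setoid α} {σ : Perm α} {i j : α} (hij : i ⋖ j)
    (hi : ∀ b, r i b → b = i) (hσ : σ i = i) :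
    HasBackwardsCycles (moveTo r i j) (σ * swap i j) ↔ HasBackwardsCycles r σ := by
  refine (swap i j).forall_congr fun {a} => isCyclicPred_moveTo hij hi ?_
  rw [Perm.mul_apply]
  nth_rw 2 [← hσ]
  rw [σ.apply_eq_iff_eq, Equiv.swap_apply_eq_iff, Equiv.swap_apply_left]

theorem HasBackwardsCycles.rel_apply {r : Setoid α} {σ : Perm α} (h : HasBackwardsCycles r σ)
    (a : α) : r a (σ a) := (h a).mem

theorem HasBackwardsCycles.eq_of_rel {r : Setoid α} {σ : Perm α} (h : HasBackwardsCycles r σ)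
    {a b : α} (ha : σ a = a) (hab : r a b) : b = a := by
  have := h a
  rw [ha] at this
  exact this.eq_of_mem hab

theorem NoncrossingRel.isolate {r : Setoid α} (hr : NoncrossingRel r) (i : α) :
    NoncrossingRel (isolate r i) := by
  intro a c b d hac hcb hbd hab hcd
  rw [isolate_iff] at *
  grind [@hr a c b d]

theorem moveTo_isolate {r : Setoid α} {i j : α} (hij : i ≠ j) (h : r i j) :
    moveTo (isolate r i) i j = r := by
  have h' := r.symm h
  ext a b
  rw [moveTo_iff, isolate_iff]
  simp only [Function.update_apply, id]
  split_ifs with ha hb hb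
  · simp [ha, hb]
  · simpa [ha, hij.symm, hb] using ⟨r.trans h, r.trans h'⟩
  · simpa [ha, hij.symm, hb] using ⟨fun hh => r.trans hh h', fun hh => r.trans hh h⟩
  · simp [ha, hb]

end Setoid

/-- The equivalence relation on `ℕ` whose classes are the blocks of `P`, and singletons. -/
def blockRel {s : Finset ℕ} (P : Finpartition s) : Setoid ℕ := .ker fun a => insert a (P.part a)

theorem blockRel_iff {s : Finset ℕ} {P : Finpartition s} {a b : ℕ} :
    blockRel P a b ↔ b = a ∨ b ∈ P.part a := by
  rw [blockRel, Setoid.ker_def]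
  refine ⟨fun h => ?_, ?_⟩
  · rw [← Finset.mem_insert, h]
    exact Finset.mem_insert_self ..
  · rintro (rfl | h)
    · rfl
    · obtain ⟨B, hB, hbB, haB⟩ := P.mem_part_iff_exists.1 h
      rw [P.part_eq_of_mem hB haB, P.part_eq_of_mem hB hbB, Finset.insert_eq_of_mem haB,
        Finset.insert_eq_of_mem hbB]

theorem IsNoncrossing.noncrossingRel {n : ℕ} {P : Finpartition (Finset.range n)}
    (hP : IsNoncrossing P) : NoncrossingRel (blockRel P) := by
  intro a c b d hac hcb hbd hab hcd
  obtain ⟨A, hA, hbA, haA⟩ := P.mem_part_iff_exists.1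
    ((blockRel_iff.1 hab).resolve_left (hac.trans hcb).ne')
  obtain ⟨B, hB, hdB, hcB⟩ := P.mem_part_iff_exists.1
    ((blockRel_iff.1 hcd).resolve_left (hcb.trans hbd).ne')
  obtain rfl : A = B := by
    by_contra hAB
    exact hP A hA B hB hAB a haA b hbA c hcB d hdB ⟨hac, hcb, hbd⟩
  exact blockRel_iff.2 (.inr (P.mem_part_iff_exists.2 ⟨A, hA, hcB, haA⟩))

theorem hasBackwardsCycles_blockRel {n : ℕ} {P : Finpartition (Finset.range n)} {σ : Perm ℕ}
    (hfix : ∀ i, n ≤ i → σ i = i) (hσ : ∀ B ∈ P.parts, IsBackwardsCycleOn σ B) :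
    HasBackwardsCycles (blockRel P) σ := by
  intro a
  simp only [blockRel_iff]
  obtain ha | ha := lt_or_ge a n
  · have haP : a ∈ P.part a := P.mem_part_self.2 (Finset.mem_range.2 ha)
    have hor (b : ℕ) : b = a ∨ b ∈ P.part a ↔ b ∈ P.part a := or_iff_right_of_imp (· ▸ haP)
    simp only [hor]
    exact hσ _ (P.part_mem.2 (Finset.mem_range.2 ha)) a haP
  · have hempty : P.part a = ∅ := P.part_eq_empty.2 (by simpa using ha)
    simpa [hempty, isCyclicPred_singleton] using hfix a ha

theorem mem_NC_iff {n : ℕ} {σ : Perm ℕ} :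
    σ ∈ NC n ↔ (∀ i, n ≤ i → σ i = i) ∧ ∃ r, NoncrossingRel r ∧ HasBackwardsCycles r σ := by
  classical
  refine and_congr_right fun hfix => ⟨?_, ?_⟩
  · rintro ⟨P, hP, hσ⟩
    exact ⟨blockRel P, hP.noncrossingRel, hasBackwardsCycles_blockRel hfix hσ⟩
  · rintro ⟨r, hr, hσ⟩
    let P := Finpartition.ofSetSetoid r (Finset.range n)
    have hmem {B : Finset ℕ} (hB : B ∈ P.parts) {a : ℕ} (ha : a ∈ B) (b : ℕ) :
        b ∈ B ↔ r a b := by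
      have han : a < n := Finset.mem_range.1 (P.subset hB ha)
      rw [← P.part_eq_of_mem hB ha, Finpartition.mem_part_ofSetSetoid_iff_rel]
      refine ⟨fun h => h.2.2, fun h => ⟨Finset.mem_range.2 han, Finset.mem_range.2 ?_, h⟩⟩
      by_contra! hbn
      exact (hσ.eq_of_rel (hfix b hbn) (r.symm h) ▸ han).not_ge hbn
    refine ⟨P, fun A hA B hB hAB a ha b hb c hc d hd ⟨hac, hcb, hbd⟩ => hAB ?_, ?_⟩
    · have hrac : r a c := hr hac hcb hbd ((hmem hA ha b).1 hb) ((hmem hB hc d).1 hd)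
      exact P.eq_of_mem_parts hA hB ((hmem hA ha c).2 hrac) hc
    · intro B hB a ha
      have hcyc := hσ a
      simp only [← hmem hB ha] at hcyc
      exact hcyc

theorem one_mem_NC (n : ℕ) : (1 : Perm ℕ) ∈ NC n := by
  refine mem_NC_iff.2 ⟨fun _ _ => rfl, ⊥, fun a c b d hac hcb _ hab => ?_, fun a => ?_⟩
  · exact absurd hab (hac.trans hcb).ne
  · have hS : {b | (⊥ : Setoid ℕ) a b} = {a} := Set.ext fun b => eq_comm
    exact hS ▸ isCyclicPred_singleton.2 rfl

theorem NCStep.symm {n : ℕ} {σ τ : Perm ℕ} (h : NCStep n σ τ) : NCStep n τ σ := by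
  obtain ⟨i, hi, hσ, rfl⟩ := h
  exact ⟨i, hi, by simpa [or_comm] using hσ, by simp [mul_assoc]⟩

theorem NCStep.mem_NC {n : ℕ} {σ τ : Perm ℕ} (h : NCStep n σ τ) (hσ : σ ∈ NC n) : τ ∈ NC n := by
  obtain ⟨hfix, r, hr, hcyc⟩ := mem_NC_iff.1 hσ
  obtain ⟨i, hi, hσi, rfl⟩ := h
  have hij : i ⋖ i + 1 := Order.covBy_add_one i
  have hfix' (k : ℕ) (hk : n ≤ k) : (σ * swap i (i + 1)) k = k := by
    rw [Perm.mul_apply, Equiv.swap_apply_of_ne_of_ne (by omega) (by omega), hfix k hk]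
  refine mem_NC_iff.2 ⟨hfix', ?_⟩
  rcases hσi with hσi | hσi
  · exact ⟨moveTo r i (i + 1), hr.moveTo hij,
      (hasBackwardsCycles_moveTo hij (fun _ => hcyc.eq_of_rel hσi) hσi).2 hcyc⟩
  · have hri : r i (i + 1) := by
      simpa only [hσi] using r.symm (hcyc.rel_apply (i + 1))
    refine ⟨isolate r i, hr.isolate i, ?_⟩
    rw [← hasBackwardsCycles_moveTo hij (fun b hb => (isolate_iff.1 hb).2.1 rfl) (by simpa),
      moveTo_isolate hij.ne hri, mul_assoc, Equiv.swap_mul_self, mul_one]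
    exact hcyc

theorem exists_apply_lt {σ : Perm ℕ} (hσ : σ ≠ 1) : ∃ b, σ b < b := by
  by_contra! hle
  refine hσ (Equiv.ext fun b => ?_)
  induction b using Nat.strong_induction_on with
  | _ b ih =>
    have hb : σ.symm b ≤ b := by simpa using hle (σ.symm b)
    rcases hb.eq_or_lt with h | h
    · exact (σ.symm_apply_eq.1 h).symm
    · have := ih _ h
      simp at this
      omega

theorem HasBackwardsCycles.apply_eq_self {r : Setoid ℕ} {σ : Perm ℕ} (hr : NoncrossingRel r)
    (hσ : HasBackwardsCycles r σ) {j : ℕ} (hlt : σ (j + 1) < j) (hj : j ≤ σ j) : σ j = j := by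
  obtain ⟨hleast, -⟩ := (hσ j).isLeast_isGreatest hj
  have hnot : ¬ r j (σ (j + 1)) := fun h => (hleast.2 h).not_gt hlt
  by_contra hne
  have hne' : σ j ≠ j + 1 := fun h =>
    hnot (r.trans (h ▸ hσ.rel_apply j) (hσ.rel_apply (j + 1)))
  exact hnot (r.symm (hr hlt (Nat.lt_succ_self j) (by omega) (r.symm (hσ.rel_apply (j + 1)))
    (hσ.rel_apply j)))

theorem exists_NCStep_descent {n : ℕ} {σ : Perm ℕ} (hσ : σ ∈ NC n) (h1 : σ ≠ 1) :
    ∃ i, i + 1 < n ∧ (σ i = i ∨ σ (i + 1) = i) ∧ σ (i + 1) < σ i := by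
  classical
  obtain ⟨hfix, r, hr, hcyc⟩ := mem_NC_iff.1 hσ
  have hex := exists_apply_lt h1
  obtain ⟨j, hj⟩ : ∃ j, Nat.find hex = j + 1 :=
    Nat.exists_eq_add_one.2 ((Nat.zero_le _).trans_lt (Nat.find_spec hex))
  have hlt : σ (j + 1) < j + 1 := hj ▸ Nat.find_spec hex
  have hle : j ≤ σ j := not_lt.1 (Nat.find_min hex (hj ▸ Nat.lt_succ_self j))
  have hn : j + 1 < n := by
    by_contra! h
    exact hlt.ne (hfix _ h)
  rcases (Nat.lt_succ_iff.1 hlt).eq_or_lt with h | h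
  · have hne : σ (j + 1) ≠ σ j := σ.injective.ne (Nat.succ_ne_self j)
    exact ⟨j, hn, .inr h, by omega⟩
  · have hself := hcyc.apply_eq_self hr h hle
    exact ⟨j, hn, .inl hself, by omega⟩

theorem sum_mul_swap_lt {n i : ℕ} (hi : i + 1 < n) {σ : Perm ℕ} (h : σ (i + 1) < σ i) :
    ∑ k ∈ Finset.range n, (n - k) * (σ * swap i (i + 1)) k <
      ∑ k ∈ Finset.range n, (n - k) * σ k := by
  have h1 : i ∈ Finset.range n := by simp; omega
  have h2 : i + 1 ∈ (Finset.range n).erase i := by simp; omega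
  rw [← Finset.add_sum_erase _ _ h1, ← Finset.add_sum_erase _ _ h2,
    ← Finset.add_sum_erase _ (fun k => (n - k) * σ k) h1,
    ← Finset.add_sum_erase _ (fun k => (n - k) * σ k) h2]
  have hrest : ∑ k ∈ ((Finset.range n).erase i).erase (i + 1), (n - k) * (σ * swap i (i + 1)) k =
      ∑ k ∈ ((Finset.range n).erase i).erase (i + 1), (n - k) * σ k := by
    refine Finset.sum_congr rfl fun k hk => ?_
    simp only [Finset.mem_erase] at hk
    rw [Perm.mul_apply, Equiv.swap_apply_of_ne_of_ne hk.2.1 hk.1]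
  obtain ⟨m, rfl⟩ : ∃ m, n = i + 1 + m := ⟨n - (i + 1), by omega⟩
  rw [hrest, Perm.mul_apply, Perm.mul_apply, Equiv.swap_apply_left, Equiv.swap_apply_right,
    show i + 1 + m - i = m + 1 by omega, show i + 1 + m - (i + 1) = m by omega]
  nlinarith

theorem eqvGen_of_mem_NC {n : ℕ} {σ : Perm ℕ} (hσ : σ ∈ NC n) :
    Relation.EqvGen (NCStep n) 1 σ := by
  induction hm : ∑ k ∈ Finset.range n, (n - k) * σ k using Nat.strong_induction_on
    generalizing σ with
  | _ m ih =>
    obtain rfl | h1 := eq_or_ne σ 1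
    · exact .refl _
    · obtain ⟨i, hi, hσi, hlt⟩ := exists_NCStep_descent hσ h1
      have hstep : NCStep n σ (σ * swap i (i + 1)) := ⟨i, hi, hσi, rfl⟩
      exact .trans _ _ _ (ih _ (hm ▸ sum_mul_swap_lt hi hlt) (hstep.mem_NC hσ) rfl)
        (.rel _ _ hstep.symm)

theorem NC_eq_eqvGen (n : ℕ) : NC n = {σ | Relation.EqvGen (NCStep n) 1 σ} := by
  refine Set.ext fun σ => ⟨eqvGen_of_mem_NC, fun h => ?_⟩
  have hle : Relation.EqvGen.setoid (NCStep n) ≤ .ker (· ∈ NC n) :=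
    Setoid.eqvGen_le fun σ τ h => propext ⟨h.mem_NC, h.symm.mem_NC⟩
  exact (hle h).mp (one_mem_NC n)


/-! ### Evaluations at noncrossing permutations -/

section Evaluation

open MvPolynomial

theorem Poly.algHom_ext {A : Type*} [Semiring A] [Algebra ℤ A] {φ ψ : Poly →ₐ[ℤ] A}
    (hx : ∀ k, φ (x k) = ψ (x k)) (ht : ∀ k, φ (t k) = ψ (t k)) : φ = ψ :=
  MvPolynomial.algHom_ext fun | .inl k => hx k | .inr k => ht k

/-- Put `t k` in position `i` and move the later `x`-variables one position to the right: the
common form of `R_i⁻` and `R_i⁺`. -/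
noncomputable def insertT (i k : ℕ) : Poly →ₐ[ℤ] Poly :=
  aeval (Sum.elim (fun j => if j < i then x j else if j = i then t k else x (j - 1)) t)

theorem insertT_x (i k j : ℕ) :
    insertT i k (x j) = if j < i then x j else if j = i then t k else x (j - 1) :=
  aeval_X _ _

theorem insertT_t (i k j : ℕ) : insertT i k (t j) = t j :=
  aeval_X _ _

theorem Rminus_eq_insertT (i : ℕ) : Rminus i = insertT i i := rfl

theorem Rplus_eq_insertT (i : ℕ) : Rplus i = insertT (i + 1) i := rfl

/-- The evaluation `f(x; t) ↦ f(t_{w(0)}, t_{w(1)}, …; t)` at an arbitrary sequence of the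
`t`-variables; `ev σ` is `evSeq σ`. -/
noncomputable def evSeq (w : ℕ → ℕ) : Poly →ₐ[ℤ] MvPolynomial ℕ ℤ :=
  aeval (Sum.elim (fun j => X (w j)) X)

theorem evSeq_insertT (w : ℕ → ℕ) (i k : ℕ) (f : Poly) :
    evSeq w (insertT i k f) =
      evSeq (fun j => if j < i then w j else if j = i then k else w (j - 1)) f := by
  refine DFunLike.congr_fun (f := (evSeq w).comp (insertT i k))
    (Poly.algHom_ext (fun j => ?_) fun j => ?_) f
  · rw [AlgHom.comp_apply, insertT_x]
    split_ifs <;> simp [evSeq, x, t, *]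
  · rw [AlgHom.comp_apply, insertT_t]
    simp [evSeq, t]

theorem ev_mul_swap {i : ℕ} {f : Poly} (hf : Rplus i f = Rminus i f) {σ : Perm ℕ}
    (hσ : σ i = i) : ev (σ * swap i (i + 1)) f = ev σ f := by
  let w : ℕ → ℕ := fun j => if j < i then σ j else σ (j + 1)
  have hminus : evSeq w (Rminus i f) = ev σ f := by
    rw [Rminus_eq_insertT, evSeq_insertT]
    refine congrArg (evSeq · f) (funext fun j => ?_)
    grind
  have hplus : evSeq w (Rplus i f) = ev (σ * swap i (i + 1)) f := by
    rw [Rplus_eq_insertT, evSeq_insertT]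
    refine congrArg (evSeq · f) (funext fun j => ?_)
    grind [Equiv.Perm.mul_apply]
  rw [← hplus, hf, hminus]

theorem NCStep.ev_eq {n : ℕ} {f : Poly} (hf : ∀ i, i + 1 < n → Rplus i f = Rminus i f)
    {σ τ : Perm ℕ} (h : NCStep n σ τ) : ev σ f = ev τ f := by
  obtain ⟨i, hi, hfix | hfix, rfl⟩ := h
  · exact (ev_mul_swap (hf i hi) hfix).symm
  · have := ev_mul_swap (hf i hi) (σ := σ * swap i (i + 1)) (by simpa using hfix)
    rwa [mul_assoc, Equiv.swap_mul_self, mul_one] at this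

theorem ev_eq_of_mem_NC {n : ℕ} {f : Poly} (hf : ∀ i, i + 1 < n → Rplus i f = Rminus i f)
    {σ : Perm ℕ} (hσ : σ ∈ NC n) : ev σ f = ev 1 f := by
  have hle : Relation.EqvGen.setoid (NCStep n) ≤ .ker (fun σ => ev σ f) :=
    Setoid.eqvGen_le fun _ _ h => h.ev_eq hf
  exact (hle (eqvGen_of_mem_NC hσ)).symm

end Evaluation

/-! ### Divided differences over a coefficient ring -/

section DividedDifferences

open MvPolynomial

variable {A : Type*} [CommRing A]

/-- Put the scalar `p` in position `i` and move the later variables one position to the right. -/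
noncomputable def insertAt (i : ℕ) (p : A) : MvPolynomial ℕ A →ₐ[A] MvPolynomial ℕ A :=
  aeval fun k => if k < i then X k else if k = i then C p else X (k - 1)

theorem insertAt_X_of_lt {i k : ℕ} (h : k < i) (p : A) : insertAt i p (X k) = X k := by
  simp [insertAt, h]

theorem insertAt_X_self (i : ℕ) (p : A) : insertAt i p (X i) = C p := by
  simp [insertAt]

theorem insertAt_X_succ {i k : ℕ} (h : i ≤ k) (p : A) : insertAt i p (X (k + 1)) = X k := by
  rw [insertAt, aeval_X, if_neg (by omega), if_neg (by omega), Nat.add_sub_cancel]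

theorem insertAt_C (i : ℕ) (p a : A) : insertAt i p (C a) = C a :=
  (insertAt i p).commutes a

theorem insertAt_comm {a b : ℕ} (h : a ≤ b) (p q : A) (f : MvPolynomial ℕ A) :
    insertAt a p (insertAt (b + 1) q f) = insertAt b q (insertAt a p f) := by
  suffices h : (insertAt a p).comp (insertAt (b + 1) q) = (insertAt b q).comp (insertAt a p) from
    DFunLike.congr_fun h f
  refine algHom_ext fun k => ?_
  rw [AlgHom.comp_apply, AlgHom.comp_apply]
  rcases lt_trichotomy k a with hka | rfl | hka
  · rw [insertAt_X_of_lt hka, insertAt_X_of_lt (by omega), insertAt_X_of_lt hka,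
      insertAt_X_of_lt (by omega)]
  · rw [insertAt_X_of_lt (by omega), insertAt_X_self, insertAt_C]
  · obtain ⟨k, rfl⟩ := Nat.exists_eq_add_one_of_ne_zero (Nat.ne_zero_of_lt hka)
    rw [insertAt_X_succ (i := a) (by omega)]
    rcases lt_trichotomy k b with hkb | rfl | hkb
    · rw [insertAt_X_of_lt (by omega), insertAt_X_of_lt hkb, insertAt_X_succ (by omega)]
    · rw [insertAt_X_self, insertAt_X_self, insertAt_C]
    · obtain ⟨k, rfl⟩ := Nat.exists_eq_add_one_of_ne_zero (Nat.ne_zero_of_lt hkb)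
      rw [insertAt_X_succ (by omega), insertAt_X_succ (by omega), insertAt_X_succ (by omega)]

theorem insertAt_eq_self {f : MvPolynomial ℕ A} {i : ℕ} (hf : ∀ j ∈ f.vars, j < i) (p : A) :
    insertAt i p f = f := by
  conv_rhs => rw [← aeval_X_left_apply f]
  exact eval₂Hom_congr' rfl (fun j hj _ => if_pos (hf j hj)) rfl

theorem exists_vars_lt (f : MvPolynomial ℕ A) : ∃ n, ∀ j ∈ f.vars, j < n :=
  ⟨f.vars.sup id + 1, fun _ hj => Nat.lt_succ_of_le (Finset.le_sup (f := id) hj)⟩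

theorem map_insertAt {B : Type*} [CommRing B] (φ : A →+* B) (i : ℕ) (p : A)
    (f : MvPolynomial ℕ A) : map φ (insertAt i p f) = insertAt i (φ p) (map φ f) := by
  induction f using MvPolynomial.induction_on with
  | C a => simp only [insertAt_C, map_C]
  | add f g hf hg => simp only [map_add, hf, hg]
  | mul_X f k hf =>
    simp only [map_mul, hf, map_X]
    congr 1
    simp only [insertAt, aeval_X]
    split_ifs <;> simp

section DegreeFiltration

variable {σ : Type*}

variable (A) in
/-- The polynomials of degree less than `d`; only `0` for `d = 0`. -/
noncomputable def degreeLT (d : ℕ) : Submodule A (MvPolynomial σ A) :=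
  restrictSupport A {s | s.degree < d}

theorem mem_degreeLT_iff {d : ℕ} {f : MvPolynomial σ A} :
    f ∈ degreeLT A d ↔ f = 0 ∨ f.totalDegree < d := by
  obtain rfl | hf := eq_or_ne f 0
  · simp
  rw [or_iff_right hf, degreeLT, mem_restrictSupport_iff]
  refine ⟨fun h => ?_, fun h s hs => (le_totalDegree hs).trans_lt h⟩
  obtain ⟨s, hs⟩ := support_nonempty.2 hf
  exact (Finset.sup_lt_iff (Nat.zero_lt_of_lt (h hs))).2 fun s hs => h hs

theorem degreeLT_mono {d e : ℕ} (h : d ≤ e) : degreeLT (σ := σ) A d ≤ degreeLT A e :=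
  restrictSupport_mono A fun _ hs => hs.trans_le h

theorem mul_mem_degreeLT {d e : ℕ} {f g : MvPolynomial σ A} (hf : f ∈ degreeLT A d)
    (hg : g ∈ degreeLT A (e + 1)) : f * g ∈ degreeLT A (d + e) := by
  refine restrictSupport_mono A ?_ (restrictSupport_add (R := A) _ _ ▸ Submodule.mul_mem_mul hf hg)
  rintro _ ⟨s, hs, u, hu, rfl⟩
  rw [Set.mem_ofPred_eq] at *
  rw [map_add]
  omega

theorem C_mem_degreeLT (a : A) : (C a : MvPolynomial σ A) ∈ degreeLT A 1 :=
  (monomial_mem_restrictSupport A).2 (by simp)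

theorem X_mem_degreeLT (i : σ) : X i ∈ degreeLT A 2 :=
  (monomial_mem_restrictSupport A).2 (by simp)

theorem X_sub_C_mul_mem_degreeLT {d : ℕ} (i : σ) (p : A) {f : MvPolynomial σ A}
    (hf : f ∈ degreeLT A (d - 1)) : (X i - C p) * f ∈ degreeLT A d := by
  cases d with
  | zero =>
    rw [mem_degreeLT_iff] at hf
    simp_all
  | succ d =>
    rw [mul_comm]
    exact mul_mem_degreeLT hf
      (sub_mem (X_mem_degreeLT i) (degreeLT_mono one_le_two (C_mem_degreeLT p)))

theorem map_mem_degreeLT {φ : MvPolynomial σ A →ₗ[A] MvPolynomial σ A} {e : ℕ}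
    (hφ : ∀ s : σ →₀ ℕ, φ (monomial s 1) ∈ degreeLT A (s.degree + 1 - e)) {d : ℕ}
    {f : MvPolynomial σ A} (hf : f ∈ degreeLT A d) : φ f ∈ degreeLT A (d - e) := by
  suffices h : degreeLT A d ≤ (degreeLT A (d - e)).comap φ from h hf
  rw [degreeLT, restrictSupport_eq_span, Submodule.span_le]
  rintro _ ⟨s, hs, rfl⟩
  exact degreeLT_mono (Nat.sub_le_sub_right hs e) (hφ s)

end DegreeFiltration

theorem insertAt_X_mem_degreeLT (i : ℕ) (p : A) (k : ℕ) : insertAt i p (X k) ∈ degreeLT A 2 := by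
  rw [insertAt, aeval_X]
  split_ifs
  · exact X_mem_degreeLT k
  · exact degreeLT_mono one_le_two (C_mem_degreeLT p)
  · exact X_mem_degreeLT _

theorem insertAt_X_sub_mem_degreeLT (i : ℕ) (p q : A) (k : ℕ) :
    insertAt i p (X k) - insertAt i q (X k) ∈ degreeLT A 1 := by
  rw [insertAt, insertAt, aeval_X, aeval_X]
  split_ifs
  · simp
  · exact sub_mem (C_mem_degreeLT p) (C_mem_degreeLT q)
  · simp

theorem insertAt_monomial_mem_degreeLT (i : ℕ) (p q : A) (s : ℕ →₀ ℕ) :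
    insertAt i p (monomial s 1) ∈ degreeLT A (s.degree + 1) ∧
      insertAt i p (monomial s 1) - insertAt i q (monomial s 1) ∈ degreeLT A s.degree := by
  obtain ⟨m, rfl⟩ := Multiset.toFinsupp.surjective s
  induction m using Multiset.induction_on with
  | empty => simpa using C_mem_degreeLT (1 : A)
  | cons k m ih =>
    obtain ⟨hmem, hsub⟩ := ih
    have hmon : monomial (Multiset.toFinsupp (k ::ₘ m)) (1 : A) =
        monomial (Multiset.toFinsupp m) 1 * X k := by
      rw [X, monomial_mul, one_mul, add_comm, ← Multiset.toFinsupp_singleton, ← map_add,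
        Multiset.singleton_add]
    have hdeg : (Multiset.toFinsupp (k ::ₘ m)).degree = (Multiset.toFinsupp m).degree + 1 := by
      rw [← Multiset.singleton_add, map_add, map_add, Multiset.toFinsupp_singleton,
        Finsupp.degree_single, add_comm]
    have hprod : ∀ a b c d : MvPolynomial ℕ A, a * b - c * d = (a - c) * d + a * (b - d) := by
      intros
      ring
    rw [hmon, hdeg, map_mul, map_mul, hprod]
    exact ⟨mul_mem_degreeLT hmem (insertAt_X_mem_degreeLT i p k),
      add_mem (mul_mem_degreeLT hsub (insertAt_X_mem_degreeLT i q k))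
        (mul_mem_degreeLT (e := 0) hmem (insertAt_X_sub_mem_degreeLT i p q k))⟩

theorem insertAt_mem_degreeLT {d i : ℕ} (p : A) {f : MvPolynomial ℕ A} (hf : f ∈ degreeLT A d) :
    insertAt i p f ∈ degreeLT A d :=
  map_mem_degreeLT (φ := (insertAt i p).toLinearMap) (e := 0)
    (fun s => (insertAt_monomial_mem_degreeLT i p p s).1) hf

theorem insertAt_sub_mem_degreeLT {d i : ℕ} (p q : A) {f : MvPolynomial ℕ A}
    (hf : f ∈ degreeLT A d) : insertAt i p f - insertAt i q f ∈ degreeLT A (d - 1) :=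
  map_mem_degreeLT (φ := (insertAt i p).toLinearMap - (insertAt i q).toLinearMap) (e := 1)
    (fun s => (insertAt_monomial_mem_degreeLT i p q s).2) hf

theorem X_sub_C_dvd_insertAt_sub (i : ℕ) (p : A) (f : MvPolynomial ℕ A) :
    X i - C p ∣ insertAt (i + 1) p f - insertAt i p f := by
  rw [← Ideal.mem_span_singleton, ← Ideal.Quotient.mk_eq_mk_iff_sub_mem]
  set π := Ideal.Quotient.mkₐ A (Ideal.span {(X i - C p : MvPolynomial ℕ A)})
  have hπ : π (X i) = π (C p) :=
    (Ideal.Quotient.mk_eq_mk_iff_sub_mem _ _).2 (Ideal.mem_span_singleton_self _)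
  suffices h : π.comp (insertAt (i + 1) p) = π.comp (insertAt i p) from DFunLike.congr_fun h f
  refine algHom_ext fun k => ?_
  rw [AlgHom.comp_apply, AlgHom.comp_apply]
  rcases lt_trichotomy k i with hk | rfl | hk
  · rw [insertAt_X_of_lt hk, insertAt_X_of_lt (by omega)]
  · rw [insertAt_X_self, insertAt_X_of_lt (by omega), hπ]
  · obtain ⟨k, rfl⟩ := Nat.exists_eq_add_one_of_ne_zero (Nat.ne_zero_of_lt hk)
    rw [insertAt_X_succ (i := i) (by omega)]
    rcases eq_or_lt_of_le (Nat.le_of_lt_succ hk) with rfl | hk'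
    · rw [insertAt_X_self, hπ]
    · rw [insertAt_X_succ (by omega)]

theorem X_sub_C_ne_zero [Nontrivial A] (i : ℕ) (p : A) : (X i - C p : MvPolynomial ℕ A) ≠ 0 := by
  intro h
  simpa using congrArg (eval fun _ => p + 1) h

variable [IsDomain A]

/-- The divided difference `(f(…, x_i, p, …) - f(…, p, x_i, …)) / (x_i - p)`. -/
noncomputable def divDiff (i : ℕ) (p : A) : MvPolynomial ℕ A →ₗ[A] MvPolynomial ℕ A where
  toFun f := (X_sub_C_dvd_insertAt_sub i p f).choose
  map_add' f g := mul_left_cancel₀ (X_sub_C_ne_zero i p) <| by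
    rw [mul_add, ← Exists.choose_spec (X_sub_C_dvd_insertAt_sub i p (f + g)),
      ← Exists.choose_spec (X_sub_C_dvd_insertAt_sub i p f),
      ← Exists.choose_spec (X_sub_C_dvd_insertAt_sub i p g), map_add, map_add]
    ring
  map_smul' a f := mul_left_cancel₀ (X_sub_C_ne_zero i p) <| by
    rw [RingHom.id_apply, mul_smul_comm,
      ← Exists.choose_spec (X_sub_C_dvd_insertAt_sub i p (a • f)),
      ← Exists.choose_spec (X_sub_C_dvd_insertAt_sub i p f), map_smul, map_smul, smul_sub]

theorem X_sub_C_mul_divDiff (i : ℕ) (p : A) (f : MvPolynomial ℕ A) :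
    (X i - C p) * divDiff i p f = insertAt (i + 1) p f - insertAt i p f :=
  (X_sub_C_dvd_insertAt_sub i p f).choose_spec.symm

theorem divDiff_eq_iff {i : ℕ} {p : A} {f g : MvPolynomial ℕ A} :
    divDiff i p f = g ↔ insertAt (i + 1) p f - insertAt i p f = (X i - C p) * g := by
  rw [← X_sub_C_mul_divDiff]
  exact (mul_right_inj' (X_sub_C_ne_zero i p)).symm

theorem divDiff_map {B : Type*} [CommRing B] [IsDomain B] (φ : A →+* B) (i : ℕ) (p : A)
    (f : MvPolynomial ℕ A) : divDiff i (φ p) (map φ f) = map φ (divDiff i p f) := by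
  rw [divDiff_eq_iff, ← map_insertAt, ← map_insertAt, ← map_sub, ← X_sub_C_mul_divDiff]
  simp

theorem divDiff_insertAt_of_le {a i : ℕ} (h : a ≤ i) (p q : A) (f : MvPolynomial ℕ A) :
    divDiff i q (insertAt a p f) = insertAt a p (divDiff (i + 1) q f) := by
  rw [divDiff_eq_iff, ← insertAt_comm h, ← insertAt_comm (by omega : a ≤ i + 1), ← map_sub,
    ← X_sub_C_mul_divDiff, map_mul, map_sub, insertAt_X_succ h, insertAt_C]

theorem divDiff_insertAt_of_lt {a i : ℕ} (h : i < a) (p q : A) (f : MvPolynomial ℕ A) :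
    divDiff i q (insertAt (a + 1) p f) = insertAt a p (divDiff i q f) := by
  rw [divDiff_eq_iff, insertAt_comm h, insertAt_comm h.le, ← map_sub, ← X_sub_C_mul_divDiff,
    map_mul, map_sub, insertAt_X_of_lt h, insertAt_C]

theorem divDiff_mul_of_lt {i j : ℕ} (h : i < j) (p q : A) (f : MvPolynomial ℕ A) :
    divDiff j p ((X i - C q) * f) = (X i - C q) * divDiff j p f := by
  rw [divDiff_eq_iff, map_mul, map_mul, mul_left_comm, X_sub_C_mul_divDiff, map_sub, map_sub,
    insertAt_X_of_lt h, insertAt_X_of_lt (by omega), insertAt_C, insertAt_C, mul_sub]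

theorem divDiff_mul_self (i : ℕ) (p : A) (f : MvPolynomial ℕ A) :
    divDiff i p ((X i - C p) * f) = insertAt (i + 1) p f := by
  rw [divDiff_eq_iff, map_mul, map_mul, map_sub, map_sub, insertAt_X_self,
    insertAt_X_of_lt (Nat.lt_succ_self i), insertAt_C, insertAt_C, sub_self, zero_mul, sub_zero]

theorem divDiff_mul_succ (i : ℕ) (p : A) (f : MvPolynomial ℕ A) :
    divDiff i p ((X (i + 1) - C p) * f) = -insertAt i p f := by
  rw [divDiff_eq_iff, map_mul, map_mul, map_sub, map_sub, insertAt_X_self,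
    insertAt_X_succ le_rfl, insertAt_C, insertAt_C, sub_self, zero_mul, zero_sub, mul_neg]

theorem divDiff_mul_of_gt {i j : ℕ} (h : i < j) (p q : A) (f : MvPolynomial ℕ A) :
    divDiff i p ((X (j + 1) - C q) * f) = (X j - C q) * divDiff i p f := by
  rw [divDiff_eq_iff, map_mul, map_mul, mul_left_comm, X_sub_C_mul_divDiff, map_sub, map_sub,
    insertAt_X_succ h, insertAt_X_succ h.le, insertAt_C, insertAt_C, mul_sub]

theorem divDiff_comm {i j : ℕ} (h : i < j) (p q : A) (f : MvPolynomial ℕ A) :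
    divDiff i p (divDiff (j + 1) q f) = divDiff j q (divDiff i p f) := by
  symm
  rw [divDiff_eq_iff, ← divDiff_insertAt_of_lt h, ← divDiff_insertAt_of_lt (by omega), ← map_sub,
    ← X_sub_C_mul_divDiff, divDiff_mul_of_gt h]

theorem sum_mul_divDiff (p : A) (f : MvPolynomial ℕ A) {i j : ℕ} (h : i ≤ j) :
    ∑ k ∈ Finset.Ico i j, (X k - C p) * divDiff k p f = insertAt j p f - insertAt i p f := by
  simp_rw [X_sub_C_mul_divDiff]
  exact Finset.sum_Ico_sub (fun k => insertAt k p f) h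

/-! ### Integration of divided differences -/

theorem mem_degreeLT_of_X_sub_C_mul {d i : ℕ} {p : A} {f : MvPolynomial ℕ A}
    (hf : (X i - C p) * f ∈ degreeLT A d) : f ∈ degreeLT A (d - 1) := by
  rw [mem_degreeLT_iff] at *
  refine or_iff_not_imp_left.2 fun h0 => ?_
  have hX : (X i - C p : MvPolynomial ℕ A).totalDegree = 1 := by
    rw [sub_eq_add_neg, ← C_neg, totalDegree_add_eq_left_of_totalDegree_lt] <;> simp
  have := hf.resolve_left (mul_ne_zero (X_sub_C_ne_zero i p) h0)
  rw [totalDegree_mul_of_isDomain (X_sub_C_ne_zero i p) h0, hX] at this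
  omega

theorem divDiff_mem_degreeLT {d i : ℕ} (p : A) {f : MvPolynomial ℕ A} (hf : f ∈ degreeLT A d) :
    divDiff i p f ∈ degreeLT A (d - 1) := by
  refine mem_degreeLT_of_X_sub_C_mul (i := i) (p := p) ?_
  rw [X_sub_C_mul_divDiff]
  exact sub_mem (insertAt_mem_degreeLT p hf) (insertAt_mem_degreeLT p hf)

theorem divDiff_sub_mem_degreeLT {d i : ℕ} (p q : A) {f : MvPolynomial ℕ A}
    (hf : f ∈ degreeLT A d) : divDiff i p f - divDiff i q f ∈ degreeLT A (d - 2) := by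
  refine mem_degreeLT_of_X_sub_C_mul (d := d - 1) (i := i) (p := p) ?_
  have key : (X i - C p) * (divDiff i p f - divDiff i q f) =
      (insertAt (i + 1) p f - insertAt (i + 1) q f) - (insertAt i p f - insertAt i q f) +
        divDiff i q f * C (p - q) := by
    rw [C_sub]
    linear_combination X_sub_C_mul_divDiff i p f - X_sub_C_mul_divDiff i q f
  rw [key]
  exact add_mem (sub_mem (insertAt_sub_mem_degreeLT p q hf) (insertAt_sub_mem_degreeLT p q hf))
    (mul_mem_degreeLT (e := 0) (divDiff_mem_degreeLT q hf) (C_mem_degreeLT _))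

theorem divDiff_sum_mul_sub {p : A} {g : ℕ → MvPolynomial ℕ A} {j m : ℕ}
    (hvars : ∀ k ∈ (g j).vars, k < j + 1 + m) :
    divDiff j p (∑ i ∈ Finset.range (j + 1 + m + 1), (X i - C p) * g i) -
        (g j - insertAt 0 p (g (j + 1))) =
      ∑ i ∈ Finset.Ico 0 j, (X i - C p) * (divDiff j p (g i) - divDiff i p (g (j + 1))) +
      ∑ i ∈ Finset.Ico (j + 1) (j + 1 + m),
        (X i - C p) * (divDiff j p (g (i + 1)) - divDiff i p (g j)) := by
  have hlow : ∑ i ∈ Finset.Ico 0 j, divDiff j p ((X i - C p) * g i) =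
      ∑ i ∈ Finset.Ico 0 j, (X i - C p) * divDiff j p (g i) :=
    Finset.sum_congr rfl fun i hi => divDiff_mul_of_lt (Finset.mem_Ico.1 hi).2 _ _ _
  have hhigh : ∑ i ∈ Finset.Ico (j + 1 + 1) (j + 1 + m + 1), divDiff j p ((X i - C p) * g i) =
      ∑ i ∈ Finset.Ico (j + 1) (j + 1 + m), (X i - C p) * divDiff j p (g (i + 1)) := by
    rw [← Finset.sum_Ico_add' _ _ _ 1]
    exact Finset.sum_congr rfl fun i hi => divDiff_mul_of_gt (Finset.mem_Ico.1 hi).1 _ _ _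
  rw [map_sum, Finset.range_eq_Ico,
    ← Finset.sum_Ico_consecutive _ (Nat.zero_le j) (show j ≤ j + 1 + m + 1 by omega),
    Finset.sum_eq_sum_Ico_succ_bot (show j < j + 1 + m + 1 by omega),
    Finset.sum_eq_sum_Ico_succ_bot (show j + 1 < j + 1 + m + 1 by omega), hlow, hhigh,
    divDiff_mul_self, divDiff_mul_succ]
  simp only [mul_sub, Finset.sum_sub_distrib, sum_mul_divDiff p (g (j + 1)) (Nat.zero_le j),
    sum_mul_divDiff p (g j) (show j + 1 ≤ j + 1 + m by omega), insertAt_eq_self hvars]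
  ring

theorem divDiff_sum_mul_sub_mem_degreeLT {p : A} {d N j : ℕ} {g : ℕ → MvPolynomial ℕ A}
    (hN : ∀ i, N ≤ i → g i = 0)
    (hg : ∀ i j, i < j → divDiff i p (g (j + 1)) - divDiff j p (g i) ∈ degreeLT A (d - 1)) :
    divDiff j p (∑ i ∈ Finset.range N, (X i - C p) * g i) - (g j - insertAt 0 p (g (j + 1))) ∈
      degreeLT A d := by
  obtain ⟨n, hn⟩ := exists_vars_lt (g j)
  have hsum : ∑ i ∈ Finset.range N, (X i - C p) * g i =
      ∑ i ∈ Finset.range (j + 1 + (n + N) + 1), (X i - C p) * g i := by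
    refine Finset.sum_subset (Finset.range_subset_range.2 (by omega)) fun i _ hi => ?_
    rw [hN i (by simpa using hi), mul_zero]
  rw [hsum, divDiff_sum_mul_sub fun k hk => (hn k hk).trans_le (by omega)]
  refine add_mem (sum_mem fun i hi => X_sub_C_mul_mem_degreeLT i p ?_)
    (sum_mem fun i hi => X_sub_C_mul_mem_degreeLT i p ?_)
  · rw [← neg_sub, neg_mem_iff]
    exact hg i j (Finset.mem_Ico.1 hi).2
  · exact hg j i (Finset.mem_Ico.1 hi).1

theorem exists_approx_integral (p : A) {d N : ℕ} {g : ℕ → MvPolynomial ℕ A}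
    (hd : ∀ i, g i ∈ degreeLT A d) (hN : ∀ i, N ≤ i → g i = 0)
    (hg : ∀ i j, i < j → divDiff i p (g (j + 1)) - divDiff j p (g i) ∈ degreeLT A (d - 2)) :
    ∃ f ∈ degreeLT A (d + 1), ∀ j, divDiff j p f - g j ∈ degreeLT A (d - 1) := by
  induction N generalizing g with
  | zero => exact ⟨0, zero_mem _, fun j => by simp [hN j]⟩
  | succ N ih =>
    obtain ⟨f, hf, hfg⟩ := ih (g := fun i => insertAt 0 p (g (i + 1)))
      (fun i => insertAt_mem_degreeLT p (hd _)) (fun i hi => by rw [hN _ (by omega), map_zero])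
      fun i j hij => by
        rw [divDiff_insertAt_of_le (Nat.zero_le i), divDiff_insertAt_of_le (Nat.zero_le j),
          ← map_sub]
        exact insertAt_mem_degreeLT p (hg _ _ (by omega))
    -- `∑ i, (X i - C p) * g i` has divided differences `g j - insertAt 0 p (g (j + 1))` up to lower
    -- order, and the shifted family `insertAt 0 p (g (i + 1))` has one term fewer.
    refine ⟨f + ∑ i ∈ Finset.range (N + 1), (X i - C p) * g i,
      add_mem hf (sum_mem fun i _ => X_sub_C_mul_mem_degreeLT i p (hd i)), fun j => ?_⟩
    have hsplit := add_mem (hfg j) (divDiff_sum_mul_sub_mem_degreeLT (j := j) hN hg)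
    rw [map_add]
    convert hsplit using 1
    ring

theorem exists_integral (t : ℕ → A) {N : ℕ} {g : ℕ → MvPolynomial ℕ A}
    (hN : ∀ i, N ≤ i → g i = 0)
    (hg : ∀ i j, i < j → divDiff i (t i) (g (j + 1)) = divDiff j (t (j + 1)) (g i)) :
    ∃ f, ∀ i, divDiff i (t i) f = g i := by
  obtain ⟨d, hd⟩ : ∃ d, ∀ i, g i ∈ degreeLT A d := by
    refine ⟨(Finset.range N).sup (fun i => (g i).totalDegree) + 1, fun i => ?_⟩
    rw [mem_degreeLT_iff, Nat.lt_succ_iff]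
    refine (lt_or_ge i N).symm.imp (hN i) fun hi => ?_
    exact Finset.le_sup (f := fun i => (g i).totalDegree) (Finset.mem_range.2 hi)
  induction d generalizing g N with
  | zero => exact ⟨0, fun i => by simpa [mem_degreeLT_iff, eq_comm] using hd i⟩
  | succ d ih =>
    obtain ⟨f, hf, hfg⟩ := exists_approx_integral 0 hd hN fun i j hij => by
      have := add_mem (divDiff_sub_mem_degreeLT (i := i) 0 (t i) (hd (j + 1)))
        (divDiff_sub_mem_degreeLT (i := j) (t (j + 1)) 0 (hd i))
      rwa [hg i j hij, sub_add_sub_cancel] at this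
    obtain ⟨n, hn⟩ := exists_vars_lt f
    obtain ⟨f', hf'⟩ := ih (N := max N n) (g := fun i => g i - divDiff i (t i) f)
      (fun i hi => by
        rw [hN i (by omega), zero_sub, neg_eq_zero, divDiff_eq_iff,
          insertAt_eq_self fun j hj => (hn j hj).trans_le (by omega),
          insertAt_eq_self fun j hj => (hn j hj).trans_le (by omega), sub_self, mul_zero])
      (fun i j hij => by rw [map_sub, map_sub, hg i j hij, divDiff_comm hij])
      (fun i => by
        have := sub_mem (divDiff_sub_mem_degreeLT (i := i) 0 (t i) hf) (hfg i)
        rwa [sub_sub_sub_cancel_left] at this)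
    exact ⟨f' + f, fun i => by rw [map_add, hf', sub_add_cancel]⟩

end DividedDifferences

/-! ### Codes and trimming -/

/-- The increasing enumeration of `ℕ \ {j}`. -/
def skip (j k : ℕ) : ℕ := if k < j then k else k + 1

theorem skip_of_lt {j k : ℕ} (h : k < j) : skip j k = k := if_pos h

theorem skip_of_le {j k : ℕ} (h : j ≤ k) : skip j k = k + 1 := if_neg h.not_gt

theorem skip_succ_succ (j k : ℕ) : skip (j + 1) (k + 1) = skip j k + 1 := by
  simp only [skip]
  split_ifs <;> omega

theorem skip_injective (j : ℕ) : Function.Injective (skip j) := fun k l h => by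
  simp only [skip] at h
  split_ifs at h <;> omega

theorem skip_skip {i j : ℕ} (h : i ≤ j) (k : ℕ) : skip (j + 1) (skip i k) = skip i (skip j k) := by
  simp only [skip]
  split_ifs <;> omega

/-- The descents of a code, which are the labels of the terminal nodes of the forest. -/
def descents (c : ℕ → ℕ) : Set ℕ := {i | 0 < c i ∧ c (i + 1) = 0}

/-- The code of the trimmed forest `F / i`, in terms of the code of `F`: lower the entry at `i` by
one and delete the entry at `i + 1`. -/
noncomputable def trimCode (c : ℕ →₀ ℕ) (i : ℕ) : ℕ →₀ ℕ :=
  (c - Finsupp.single i 1).comapDomain (skip (i + 1)) (skip_injective _).injOn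

theorem trimCode_apply (c : ℕ →₀ ℕ) (i k : ℕ) :
    trimCode c i k = c (skip (i + 1) k) - if k = i then 1 else 0 := by
  simp only [trimCode, skip, Finsupp.comapDomain_apply, Finsupp.tsub_apply, Finsupp.single_apply]
  grind

theorem trimCode_comm {i j : ℕ} (h : i < j) (c : ℕ →₀ ℕ) :
    trimCode (trimCode c (j + 1)) i = trimCode (trimCode c i) j := by
  ext k
  simp only [trimCode_apply]
  grind [skip]

theorem mem_descents_trimCode_of_lt {i j : ℕ} (h : i < j) (c : ℕ →₀ ℕ) :
    i ∈ descents (trimCode c (j + 1)) ↔ i ∈ descents c := by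
  simp only [descents, Set.mem_ofPred_eq, trimCode_apply]
  rw [skip_of_lt (by omega), skip_of_lt (by omega), if_neg (by omega), if_neg (by omega)]
  rfl

theorem mem_descents_trimCode_of_gt {i j : ℕ} (h : i < j) (c : ℕ →₀ ℕ) :
    j ∈ descents (trimCode c i) ↔ j + 1 ∈ descents c := by
  simp only [descents, Set.mem_ofPred_eq, trimCode_apply]
  rw [skip_of_le (by omega), skip_of_le (by omega), if_neg (by omega), if_neg (by omega)]
  rfl

theorem degree_trimCode {c : ℕ →₀ ℕ} {i : ℕ} (h : i ∈ descents c) :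
    (trimCode c i).degree + 1 = c.degree := by
  have hle : Finsupp.single i 1 ≤ c := Finsupp.single_le_iff.2 h.1
  have hsupp : ((c - Finsupp.single i 1).support : Set ℕ) ⊆ Set.range (skip (i + 1)) := by
    intro k hk
    have hne : k ≠ i + 1 := by
      rintro rfl
      simp [h.2] at hk
    rcases hne.lt_or_gt with hlt | hgt
    · exact ⟨k, skip_of_lt hlt⟩
    · exact ⟨k - 1, (skip_of_le (by omega)).trans (by omega)⟩
  rw [← tsub_add_cancel_of_le hle, map_add, Finsupp.degree_single, tsub_add_cancel_of_le hle,
    ← Finsupp.mapDomain_comapDomain _ (skip_injective (i + 1)) _ hsupp,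
    Finsupp.degree_mapDomain]
  rfl

/-! ### Codes of forests -/

theorem treeCode_of_ge (T : BinaryTree Unit) {a i : ℕ} (h : a + T.numLeaves ≤ i + 1) :
    treeCode T a i = 0 := by
  induction T generalizing a with
  | nil => rfl
  | node _ l r hl hr =>
    have := l.numLeaves_pos
    have := r.numLeaves_pos
    rw [BinaryTree.numLeaves] at h
    rw [treeCode, hl (by omega), hr (by omega), if_neg (by omega)]

theorem treeCode_self_pos {T : BinaryTree Unit} (h : T ≠ .nil) (a : ℕ) : 0 < treeCode T a a := by
  cases T with
  | nil => exact absurd rfl h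
  | node _ l r =>
    rw [treeCode, if_pos rfl]
    omega

theorem one_lt_numLeaves {T : BinaryTree Unit} (h : T ≠ .nil) : 1 < T.numLeaves := by
  cases T with
  | nil => exact absurd rfl h
  | node _ l r => exact Nat.add_le_add l.numLeaves_pos r.numLeaves_pos

theorem mem_treeQDes_node {l r : BinaryTree Unit} {a i : ℕ}
    (h : ¬(l = .nil ∧ r = .nil ∧ i = a)) (u : Unit) :
    i ∈ treeQDes (.node u l r) a ↔ i ∈ treeQDes l a ∨ i ∈ treeQDes r (a + l.numLeaves) := by
  cases l <;> cases r <;> simp_all [treeQDes]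

theorem treeTrim_node {l r : BinaryTree Unit} {a i : ℕ} (h : ¬(l = .nil ∧ r = .nil ∧ i = a))
    (u : Unit) :
    treeTrim (.node u l r) a i =
      .node () (treeTrim l a i) (treeTrim r (a + l.numLeaves) i) := by
  cases l <;> cases r <;> simp_all [treeTrim]

theorem treeTrim_succ (T : BinaryTree Unit) (a i : ℕ) :
    treeTrim T (a + 1) (i + 1) = treeTrim T a i := by
  induction T generalizing a with
  | nil => rfl
  | node u l r hl hr =>
    by_cases h : l = .nil ∧ r = .nil ∧ i = a
    · obtain ⟨rfl, rfl, rfl⟩ := h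
      simp [treeTrim]
    · rw [treeTrim_node h, treeTrim_node (by simpa using h), hl, add_right_comm, hr]

theorem treeQDes_eq_descents (T : BinaryTree Unit) (a : ℕ) :
    treeQDes T a = descents (treeCode T a) := by
  induction T generalizing a with
  | nil => simp [treeQDes, descents, treeCode]
  | node u l r hl hr =>
    ext i
    have := l.numLeaves_pos
    by_cases h : l = .nil ∧ r = .nil ∧ i = a
    · obtain ⟨rfl, rfl, rfl⟩ := h
      simp [treeQDes, descents, treeCode]
    · rw [mem_treeQDes_node h, hl, hr]
      simp only [descents, Set.mem_ofPred_eq, treeCode]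
      change _ ∨ _ ↔ _
      rcases lt_trichotomy i a with hi | rfl | hi
      · simp [treeCode_of_lt l a i hi, treeCode_of_lt r (a + l.numLeaves) i (by omega), hi.ne]
      · rw [treeCode_of_lt r _ i (by omega)]
        by_cases hnil : l = .nil
        · subst hnil
          have := treeCode_self_pos (T := r) (fun hr => h ⟨rfl, hr, rfl⟩) (i + 1)
          simp only [treeCode, BinaryTree.numLeaves]
          omega
        · have := treeCode_self_pos hnil i
          have := one_lt_numLeaves hnil
          rw [treeCode_of_lt r _ (i + 1) (by omega)]
          simp
          omega
      · rw [if_neg hi.ne', if_neg (by omega)]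
        rcases Nat.lt_or_ge (i + 1) (a + l.numLeaves) with hlt | hge
        · rw [treeCode_of_lt r _ i (by omega), treeCode_of_lt r _ (i + 1) hlt]
          omega
        · rw [treeCode_of_ge l hge, treeCode_of_ge l (i := i + 1) (by omega)]
          omega

theorem le_of_mem_treeQDes {T : BinaryTree Unit} {a i : ℕ} (h : i ∈ treeQDes T a) : a ≤ i := by
  rw [treeQDes_eq_descents] at h
  by_contra hlt
  exact h.1.ne' (treeCode_of_lt T a i (by omega))

theorem lt_of_mem_treeQDes {T : BinaryTree Unit} {a i : ℕ} (h : i ∈ treeQDes T a) :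
    i + 1 < a + T.numLeaves := by
  rw [treeQDes_eq_descents] at h
  by_contra hge
  exact h.1.ne' (treeCode_of_ge T (by omega))

theorem treeTrim_of_notMem {T : BinaryTree Unit} {a i : ℕ} (h : i ∉ treeQDes T a) :
    treeTrim T a i = T := by
  induction T generalizing a with
  | nil => rfl
  | node u l r hl hr =>
    have hn : ¬(l = .nil ∧ r = .nil ∧ i = a) := by
      rintro ⟨rfl, rfl, rfl⟩
      exact h rfl
    rw [mem_treeQDes_node hn, not_or] at h
    rw [treeTrim_node hn, hl h.1, hr h.2]

theorem numLeaves_treeTrim {T : BinaryTree Unit} {a i : ℕ} (h : i ∈ treeQDes T a) :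
    (treeTrim T a i).numLeaves + 1 = T.numLeaves := by
  induction T generalizing a with
  | nil => exact h.elim
  | node u l r hl hr =>
    by_cases hn : l = .nil ∧ r = .nil ∧ i = a
    · obtain ⟨rfl, rfl, rfl⟩ := hn
      simp [treeTrim, BinaryTree.numLeaves]
    · rw [treeTrim_node hn, BinaryTree.numLeaves, BinaryTree.numLeaves]
      rcases (mem_treeQDes_node hn u).1 h with h | h
      · have hr' : i ∉ treeQDes r (a + l.numLeaves) := fun h' => by
          have := le_of_mem_treeQDes h'
          have := lt_of_mem_treeQDes h
          omega
        rw [treeTrim_of_notMem hr', ← hl h]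
        omega
      · have hl' : i ∉ treeQDes l a := fun h' => by
          have := le_of_mem_treeQDes h
          have := lt_of_mem_treeQDes h'
          omega
        rw [treeTrim_of_notMem hl', ← hr h]
        omega

theorem treeCode_treeTrim {T : BinaryTree Unit} {a i : ℕ} (h : i ∈ treeQDes T a) (k : ℕ) :
    treeCode (treeTrim T a i) a k + (if k = i then 1 else 0) = treeCode T a (skip (i + 1) k) := by
  induction T generalizing a with
  | nil => exact h.elim
  | node u l r hl hr =>
    by_cases hn : l = .nil ∧ r = .nil ∧ i = a
    · obtain ⟨rfl, rfl, rfl⟩ := hn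
      simp only [treeTrim, treeCode, if_true, skip]
      grind
    rw [treeTrim_node hn, treeCode, treeCode]
    rcases (mem_treeQDes_node hn u).1 h with h | h
    · have hle := le_of_mem_treeQDes h
      have hlt := lt_of_mem_treeQDes h
      have hr' : i ∉ treeQDes r (a + l.numLeaves) := fun h' => by
        have := le_of_mem_treeQDes h'
        omega
      have hcode : treeCode r (a + (treeTrim l a i).numLeaves) k =
          treeCode r (a + l.numLeaves) (skip (i + 1) k) := by
        rw [← numLeaves_treeTrim h] at hlt ⊢
        rcases Nat.lt_or_ge k (i + 1) with hk | hk
        · rw [skip_of_lt hk, treeCode_of_lt r _ _ (by omega), treeCode_of_lt r _ _ (by omega)]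
        · rw [skip_of_le hk, ← add_assoc, treeCode_succ]
      rw [treeTrim_of_notMem hr', hcode, ← hl h]
      grind [skip]
    · have hle := le_of_mem_treeQDes h
      have hl' : i ∉ treeQDes l a := fun h' => by
        have := lt_of_mem_treeQDes h'
        omega
      have hcode : treeCode l a (skip (i + 1) k) = treeCode l a k := by
        rcases Nat.lt_or_ge k (i + 1) with hk | hk
        · rw [skip_of_lt hk]
        · rw [skip_of_le hk, treeCode_of_ge l (by omega), treeCode_of_ge l (by omega)]
      rw [treeTrim_of_notMem hl', hcode, ← hr h]
      grind [skip]

theorem mem_treeQDes_succ (T : BinaryTree Unit) (a i : ℕ) :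
    i + 1 ∈ treeQDes T (a + 1) ↔ i ∈ treeQDes T a := by
  simp only [treeQDes_eq_descents, descents, Set.mem_ofPred_eq, treeCode_succ]

theorem mem_treeQDes_spine_succ (F : IndexedForest) (N i : ℕ) :
    i + 1 ∈ treeQDes (spine F.tree N) 0 ↔ ∃ j < N, i ∈ treeQDes (F.tree j) (F.firstLeaf j) := by
  induction N with
  | zero => simp [spine, treeQDes]
  | succ N ih =>
    rw [spine, mem_treeQDes_node (by simp), ih, numLeaves_spine, zero_add, mem_treeQDes_succ,
      Nat.exists_lt_succ_right]

theorem treeTrim_spine_succ (F : IndexedForest) (N i : ℕ) :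
    treeTrim (spine F.tree N) 0 (i + 1) = spine (F.trim i).tree N := by
  induction N with
  | zero => rfl
  | succ N ih =>
    rw [spine, treeTrim_node (by simp), ih, numLeaves_spine, zero_add, treeTrim_succ]
    rfl

namespace IndexedForest

theorem code_eq_treeCode_spine (F : IndexedForest) {i N : ℕ} (h : i < N) :
    F.code i = treeCode (spine F.tree N) 0 (i + 1) := by
  rw [treeCode_spine_succ]
  refine Finset.sum_subset (Finset.range_mono h) fun j _ hj => treeCode_of_lt _ _ _ ?_
  have := F.le_firstLeaf j
  simp only [Finset.mem_range] at hj
  omega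

theorem mem_qdes_iff_mem_treeQDes_spine (F : IndexedForest) {i N : ℕ} (h : i < N) :
    i ∈ F.qdes ↔ i + 1 ∈ treeQDes (spine F.tree N) 0 := by
  rw [mem_treeQDes_spine_succ]
  exact exists_congr fun j => (and_iff_right_of_imp fun hj =>
    ((F.le_firstLeaf j).trans (le_of_mem_treeQDes hj)).trans_lt h).symm

theorem qdes_eq_descents (F : IndexedForest) : F.qdes = descents F.code := by
  ext i
  have hi : i < i + 2 := by omega
  rw [F.mem_qdes_iff_mem_treeQDes_spine hi, treeQDes_eq_descents]
  simp only [descents, Set.mem_ofPred_eq, F.code_eq_treeCode_spine hi,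
    F.code_eq_treeCode_spine (Nat.lt_succ_self (i + 1))]

theorem code_trim (F : IndexedForest) {i : ℕ} (hi : i ∈ F.qdes) (k : ℕ) :
    (F.trim i).code k + (if k = i then 1 else 0) = F.code (skip (i + 1) k) := by
  have hskip : skip (i + 1) k ≤ k + 1 := by grind [skip]
  have hi' := (F.mem_qdes_iff_mem_treeQDes_spine (N := i + k + 2) (by omega)).1 hi
  have h := treeCode_treeTrim hi' (k + 1)
  rw [treeTrim_spine_succ, ← code_eq_treeCode_spine _ (by omega), skip_succ_succ,
    ← code_eq_treeCode_spine _ (by omega)] at h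
  simpa only [Nat.add_right_cancel_iff] using h

theorem finite_support_code (F : IndexedForest) : F.code.support.Finite := by
  refine (F.finite.biUnion fun j _ =>
    Set.finite_Iio (F.firstLeaf j + (F.tree j).numLeaves)).subset fun i hi => ?_
  obtain ⟨j, -, hj⟩ := Finset.exists_ne_zero_of_sum_ne_zero hi
  refine Set.mem_biUnion (x := j) (fun hnil => hj ?_) (Set.mem_Iio.2 (not_le.1 fun hle => hj ?_))
  · rw [hnil, treeCode]
  · exact treeCode_of_ge _ (by omega)

/-- The code of a forest as a finitely supported function. -/
noncomputable def finsuppCode (F : IndexedForest) : ℕ →₀ ℕ :=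
  Finsupp.ofSupportFinite F.code F.finite_support_code

theorem coe_finsuppCode (F : IndexedForest) : ⇑F.finsuppCode = F.code := rfl

theorem finsuppCode_trim (F : IndexedForest) {i : ℕ} (hi : i ∈ F.qdes) :
    (F.trim i).finsuppCode = trimCode F.finsuppCode i := by
  ext k
  rw [trimCode_apply, coe_finsuppCode, coe_finsuppCode, ← F.code_trim hi, Nat.add_sub_cancel]

theorem finsuppCode_eq_zero_iff {F : IndexedForest} : F.finsuppCode = 0 ↔ F = empty := by
  constructor
  · intro h
    ext1
    funext j
    by_contra hne
    have hcode : F.code (F.firstLeaf j) = 0 := DFunLike.congr_fun h (F.firstLeaf j)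
    exact (treeCode_self_pos hne (F.firstLeaf j)).ne' (Finset.sum_eq_zero_iff.1 hcode j
      (Finset.mem_range.2 (Nat.lt_succ_of_le (F.le_firstLeaf j))))
  · rintro rfl
    ext i
    simp [coe_finsuppCode, code, empty, treeCode]

end IndexedForest

/-! ### Existence and uniqueness of double forest polynomials -/

section Construction

open MvPolynomial

theorem sumAlgEquiv_insertT (i k : ℕ) (f : Poly) :
    sumAlgEquiv ℤ ℕ ℕ (insertT i k f) = insertAt i (X k) (sumAlgEquiv ℤ ℕ ℕ f) := by
  suffices h : (sumAlgEquiv ℤ ℕ ℕ).toAlgHom.comp (insertT i k) =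
      ((insertAt i (X k : MvPolynomial ℕ ℤ)).restrictScalars ℤ).comp
        (sumAlgEquiv ℤ ℕ ℕ).toAlgHom from DFunLike.congr_fun h f
  refine Poly.algHom_ext (fun j => ?_) fun j => ?_
  · rw [AlgHom.comp_apply, insertT_x]
    simp only [insertAt, x, t, AlgHom.comp_apply, AlgEquiv.toAlgHom_apply, sumAlgEquiv_X_inl,
      AlgHom.restrictScalars_apply, aeval_X]
    split_ifs <;> simp
  · rw [AlgHom.comp_apply, insertT_t]
    simp [insertAt, t]

theorem isDividedDifference_iff {i : ℕ} {f g : Poly} : IsDividedDifference i f g ↔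
    divDiff i (X i) (sumAlgEquiv ℤ ℕ ℕ f) = sumAlgEquiv ℤ ℕ ℕ g := by
  rw [divDiff_eq_iff, ← sumAlgEquiv_insertT, ← sumAlgEquiv_insertT, IsDividedDifference,
    Rplus_eq_insertT, Rminus_eq_insertT, ← (sumAlgEquiv ℤ ℕ ℕ).injective.eq_iff]
  simp [x, t]

theorem omitT_eq_rename (i : ℕ) : omitT i = rename (Sum.map id (skip i)) := by
  refine algHom_ext fun j => ?_
  rcases j with j | j
  · simp [omitT, x]
  · simp only [omitT, t, aeval_X, Sum.elim_inr, rename_X, Sum.map_inr, skip]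
    split_ifs <;> rfl

theorem omitT_omitT {i j : ℕ} (h : i ≤ j) (f : Poly) :
    omitT (j + 1) (omitT i f) = omitT i (omitT j f) := by
  simp only [omitT_eq_rename, rename_rename, Sum.map_comp_map]
  congr 3
  exact funext (skip_skip h)

theorem isHomogeneous_omitT {f : Poly} {d : ℕ} (hf : f.IsHomogeneous d) (i : ℕ) :
    (omitT i f).IsHomogeneous d := by
  rw [omitT_eq_rename]
  exact hf.rename_isHomogeneous

theorem sumAlgEquiv_omitT (i : ℕ) (f : Poly) :
    sumAlgEquiv ℤ ℕ ℕ (omitT i f) =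
      map (rename (skip i) : MvPolynomial ℕ ℤ →ₐ[ℤ] _).toRingHom (sumAlgEquiv ℤ ℕ ℕ f) := by
  suffices h : (sumAlgEquiv ℤ ℕ ℕ).toAlgHom.comp (omitT i) =
      (mapAlgHom (rename (skip i) : MvPolynomial ℕ ℤ →ₐ[ℤ] _)).comp
        (sumAlgEquiv ℤ ℕ ℕ).toAlgHom from DFunLike.congr_fun h f
  refine algHom_ext fun j => ?_
  rcases j with j | j <;> simp [omitT_eq_rename]

theorem IsDividedDifference.divDiff_omitT {k : ℕ} {f g : Poly} (h : IsDividedDifference k f g)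
    (i : ℕ) : divDiff k (X (skip i k)) (sumAlgEquiv ℤ ℕ ℕ (omitT i f)) =
      sumAlgEquiv ℤ ℕ ℕ (omitT i g) := by
  rw [sumAlgEquiv_omitT, sumAlgEquiv_omitT, ← isDividedDifference_iff.1 h, ← divDiff_map]
  simp

theorem exists_isDividedDifference {N : ℕ} {g : ℕ → Poly} (hN : ∀ i, N ≤ i → g i = 0)
    (hg : ∀ i j, i < j → divDiff i (X i) (sumAlgEquiv ℤ ℕ ℕ (g (j + 1))) =
      divDiff j (X (j + 1)) (sumAlgEquiv ℤ ℕ ℕ (g i))) :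
    ∃ f, ∀ i, IsDividedDifference i f (g i) := by
  obtain ⟨f, hf⟩ := exists_integral (fun i => (X i : MvPolynomial ℕ ℤ)) (N := N)
    (g := fun i => sumAlgEquiv ℤ ℕ ℕ (g i)) (fun i hi => by rw [hN i hi, map_zero]) hg
  refine ⟨(sumAlgEquiv ℤ ℕ ℕ).symm f, fun i => ?_⟩
  rw [isDividedDifference_iff, AlgEquiv.apply_symm_apply]
  exact hf i

theorem homogeneousComponent_aeval {R σ τ : Type*} [CommSemiring R] {φ : σ → MvPolynomial τ R}
    (hφ : ∀ k, (φ k).IsHomogeneous 1) (n : ℕ) (f : MvPolynomial σ R) :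
    homogeneousComponent n (aeval φ f) = aeval φ (homogeneousComponent n f) := by
  have hcomp (m : ℕ) : homogeneousComponent n (aeval φ (homogeneousComponent m f)) =
      if n = m then aeval φ (homogeneousComponent n f) else 0 := by
    have h := (homogeneousComponent_isHomogeneous m f).aeval φ hφ
    rw [one_mul] at h
    rw [homogeneousComponent_of_mem h]
    split_ifs with hnm
    · rw [hnm]
    · rfl
  conv_lhs => rw [← sum_homogeneousComponent f]
  rw [map_sum, map_sum, Finset.sum_congr rfl fun m _ => hcomp m, Finset.sum_ite_eq]
  split_ifs with h
  · rfl
  · rw [homogeneousComponent_eq_zero _ _ (by simpa using h), map_zero]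

theorem homogeneousComponent_insertT (i k n : ℕ) (f : Poly) :
    homogeneousComponent n (insertT i k f) = insertT i k (homogeneousComponent n f) := by
  refine homogeneousComponent_aeval ?_ n f
  rintro (j | j)
  · rw [Sum.elim_inl]
    split_ifs <;> exact isHomogeneous_X _ _
  · exact isHomogeneous_X _ _

theorem homogeneousComponent_ev (σ : Perm ℕ) (n : ℕ) (f : Poly) :
    homogeneousComponent n (ev σ f) = ev σ (homogeneousComponent n f) := by
  refine homogeneousComponent_aeval ?_ n f
  rintro (j | j) <;> exact isHomogeneous_X _ _

theorem IsDividedDifference.homogeneousComponent {i d : ℕ} {f g : Poly}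
    (h : IsDividedDifference i f g) (hg : g.IsHomogeneous d) :
    IsDividedDifference i (homogeneousComponent (d + 1) f) g := by
  rw [IsDividedDifference, Rplus_eq_insertT, Rminus_eq_insertT] at h ⊢
  rw [← homogeneousComponent_insertT, ← homogeneousComponent_insertT, ← map_sub, h]
  refine homogeneousComponent_eq_self ?_
  rw [add_comm]
  exact ((isHomogeneous_X _ _).sub (isHomogeneous_X _ _)).mul hg

theorem insertT_rename_inr (i k : ℕ) (q : MvPolynomial ℕ ℤ) :
    insertT i k (rename Sum.inr q) = rename Sum.inr q := by
  suffices h : (insertT i k).comp (rename Sum.inr) = rename Sum.inr from DFunLike.congr_fun h q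
  refine MvPolynomial.algHom_ext fun j => ?_
  rw [AlgHom.comp_apply, rename_X]
  exact insertT_t i k j

theorem IsDividedDifference.sub_rename_inr {i : ℕ} {f g : Poly} (h : IsDividedDifference i f g)
    (q : MvPolynomial ℕ ℤ) : IsDividedDifference i (f - rename Sum.inr q) g := by
  rw [IsDividedDifference, Rplus_eq_insertT, Rminus_eq_insertT] at h ⊢
  rw [map_sub, map_sub, insertT_rename_inr, insertT_rename_inr, sub_sub_sub_cancel_right, h]

theorem ev_rename_inr (σ : Perm ℕ) (q : MvPolynomial ℕ ℤ) : ev σ (rename Sum.inr q) = q := by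
  rw [ev, aeval_rename]
  exact aeval_X_left_apply q

/-- The conditions that characterize the double forest polynomial of the forest with code `c`, with
divided differences prescribed by `g`. -/
structure IsForestPoly (c : ℕ →₀ ℕ) (g : ℕ → Poly) (f : Poly) : Prop where
  homogeneous : f.IsHomogeneous c.degree
  ev_one : ev 1 f = if c = 0 then 1 else 0
  isDividedDifference : ∀ i, IsDividedDifference i f (g i)

open Classical in
/-- The double forest polynomial of the forest with code `c`. The choice is among the polynomials
with the prescribed divided differences; `forestPoly_spec` shows that there is one. -/
noncomputable def forestPoly (c : ℕ →₀ ℕ) : Poly :=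
  Classical.epsilon <| IsForestPoly c fun i =>
    if _h : i ∈ descents c then omitT i (forestPoly (trimCode c i)) else 0
termination_by c.degree
decreasing_by exact Nat.lt_of_succ_le (degree_trimCode _h).le

open Classical in
/-- The `i`-th divided difference of the double forest polynomial with code `c`. -/
noncomputable def forestDivDiff (c : ℕ →₀ ℕ) (i : ℕ) : Poly :=
  if i ∈ descents c then omitT i (forestPoly (trimCode c i)) else 0

theorem forestDivDiff_of_mem {c : ℕ →₀ ℕ} {i : ℕ} (h : i ∈ descents c) :
    forestDivDiff c i = omitT i (forestPoly (trimCode c i)) := if_pos h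

theorem forestDivDiff_of_notMem {c : ℕ →₀ ℕ} {i : ℕ} (h : i ∉ descents c) :
    forestDivDiff c i = 0 := if_neg h

theorem isForestPoly_forestPoly {c : ℕ →₀ ℕ} (h : ∃ f, IsForestPoly c (forestDivDiff c) f) :
    IsForestPoly c (forestDivDiff c) (forestPoly c) := by
  rw [forestPoly]
  exact Classical.epsilon_spec h

theorem omitT_forestDivDiff_trimCode {c : ℕ →₀ ℕ} {i j : ℕ} (h : i < j) (hi : i ∈ descents c)
    (hj : j + 1 ∈ descents c) :
    omitT (j + 1) (forestDivDiff (trimCode c (j + 1)) i) =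
      omitT i (forestDivDiff (trimCode c i) j) := by
  rw [forestDivDiff_of_mem ((mem_descents_trimCode_of_lt h c).2 hi),
    forestDivDiff_of_mem ((mem_descents_trimCode_of_gt h c).2 hj), trimCode_comm h,
    omitT_omitT h.le]

theorem divDiff_forestDivDiff {c : ℕ →₀ ℕ} (hc : ∀ i ∈ descents c,
      IsForestPoly (trimCode c i) (forestDivDiff (trimCode c i)) (forestPoly (trimCode c i)))
    {i j : ℕ} (h : i < j) :
    divDiff i (X i) (sumAlgEquiv ℤ ℕ ℕ (forestDivDiff c (j + 1))) =
      divDiff j (X (j + 1)) (sumAlgEquiv ℤ ℕ ℕ (forestDivDiff c i)) := by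
  have hdiv {k : ℕ} (hk : k ∈ descents c) (l : ℕ) :
      divDiff l (X (skip k l)) (sumAlgEquiv ℤ ℕ ℕ (forestDivDiff c k)) =
        sumAlgEquiv ℤ ℕ ℕ (omitT k (forestDivDiff (trimCode c k) l)) := by
    rw [forestDivDiff_of_mem hk]
    exact ((hc k hk).isDividedDifference l).divDiff_omitT k
  have hleft := fun hj : j + 1 ∈ descents c => hdiv hj i
  have hright := fun hi : i ∈ descents c => hdiv hi j
  rw [skip_of_lt (h.trans j.lt_succ_self)] at hleft
  rw [skip_of_le h.le] at hright
  by_cases hi : i ∈ descents c <;> by_cases hj : j + 1 ∈ descents c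
  · rw [hleft hj, hright hi, omitT_forestDivDiff_trimCode h hi hj]
  · rw [hright hi, forestDivDiff_of_notMem hj,
      forestDivDiff_of_notMem (mt (mem_descents_trimCode_of_gt h c).1 hj)]
    simp
  · rw [hleft hj, forestDivDiff_of_notMem hi,
      forestDivDiff_of_notMem (mt (mem_descents_trimCode_of_lt h c).1 hi)]
    simp
  · rw [forestDivDiff_of_notMem hi, forestDivDiff_of_notMem hj]
    simp

theorem isForestPoly_zero_one : IsForestPoly 0 (forestDivDiff 0) 1 where
  homogeneous := isHomogeneous_one _ _
  ev_one := by rw [if_pos rfl, map_one]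
  isDividedDifference i := by
    rw [forestDivDiff_of_notMem fun h => lt_irrefl 0 h.1]
    simp [IsDividedDifference]

theorem exists_isForestPoly {c : ℕ →₀ ℕ} (hc : ∀ i ∈ descents c,
      IsForestPoly (trimCode c i) (forestDivDiff (trimCode c i)) (forestPoly (trimCode c i))) :
    ∃ f, IsForestPoly c (forestDivDiff c) f := by
  rcases eq_or_ne c 0 with rfl | h0
  · exact ⟨1, isForestPoly_zero_one⟩
  obtain ⟨d, hd⟩ := Nat.exists_eq_succ_of_ne_zero (mt (Finsupp.degree_eq_zero_iff c).1 h0)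
  obtain ⟨N, hN⟩ := Finset.exists_nat_subset_range c.support
  obtain ⟨f, hf⟩ := exists_isDividedDifference (N := N) (g := forestDivDiff c)
    (fun i hi => forestDivDiff_of_notMem fun h => hi.not_gt
      (Finset.mem_range.1 (hN (Finsupp.mem_support_iff.2 h.1.ne'))))
    fun i j h => divDiff_forestDivDiff hc h
  have hhom (i : ℕ) : (forestDivDiff c i).IsHomogeneous d := by
    by_cases hi : i ∈ descents c
    · have hdeg : (trimCode c i).degree = d := Nat.succ_injective ((degree_trimCode hi).trans hd)
      rw [forestDivDiff_of_mem hi, ← hdeg]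
      exact isHomogeneous_omitT (hc i hi).homogeneous i
    · rw [forestDivDiff_of_notMem hi]
      exact isHomogeneous_zero _ _ _
  refine ⟨MvPolynomial.homogeneousComponent (d + 1) (f - rename Sum.inr (ev 1 f)), ?_, ?_,
    fun i => ((hf i).sub_rename_inr _).homogeneousComponent (hhom i)⟩
  · rw [hd]
    exact homogeneousComponent_isHomogeneous _ _
  · rw [← homogeneousComponent_ev, map_sub, ev_rename_inr, sub_self, map_zero, if_neg h0]

theorem forestPoly_spec (c : ℕ →₀ ℕ) : IsForestPoly c (forestDivDiff c) (forestPoly c) :=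
  isForestPoly_forestPoly <| exists_isForestPoly fun i hi =>
    have : (trimCode c i).degree < c.degree := Nat.lt_of_succ_le (degree_trimCode hi).le
    forestPoly_spec (trimCode c i)
termination_by c.degree

theorem isDoubleForestFamily_forestPoly :
    IsDoubleForestFamily fun F => forestPoly F.finsuppCode where
  homogeneous F := ⟨_, (forestPoly_spec F.finsuppCode).homogeneous⟩
  ev_empty := by
    rw [(forestPoly_spec _).ev_one, if_pos (IndexedForest.finsuppCode_eq_zero_iff.2 rfl)]
  ev_of_ne F hF := by
    rw [(forestPoly_spec _).ev_one, if_neg (mt IndexedForest.finsuppCode_eq_zero_iff.1 hF)]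
  trim_mem F i hi := by
    have h := (forestPoly_spec F.finsuppCode).isDividedDifference i
    rwa [forestDivDiff_of_mem (F.qdes_eq_descents ▸ hi), ← F.finsuppCode_trim hi] at h
  trim_notMem F i hi := by
    have h := (forestPoly_spec F.finsuppCode).isDividedDifference i
    rwa [forestDivDiff_of_notMem (F.qdes_eq_descents ▸ hi)] at h

end Construction

section Uniqueness

open MvPolynomial

/-- The substitution `x j ↦ t j` for `j ≥ m`. -/
noncomputable def specializeFrom (m : ℕ) : Poly →ₐ[ℤ] Poly :=
  aeval (Sum.elim (fun j => if j < m then x j else t j) t)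

theorem specializeFrom_zero (f : Poly) : specializeFrom 0 f = rename Sum.inr (ev 1 f) := by
  suffices h : specializeFrom 0 = (rename Sum.inr).comp (ev 1) from DFunLike.congr_fun h f
  refine algHom_ext fun k => ?_
  rcases k with k | k <;> simp [specializeFrom, ev, t]

theorem exists_specializeFrom_eq_self (f : Poly) : ∃ m, specializeFrom m f = f := by
  classical
  obtain ⟨m, hm⟩ := Finset.exists_nat_subset_range (f.vars.image (Sum.elim id id))
  refine ⟨m, ?_⟩
  conv_rhs => rw [← aeval_X_left_apply f]
  refine eval₂Hom_congr' rfl (fun k hk _ => ?_) rfl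
  have hlt := Finset.mem_range.1 (hm (Finset.mem_image_of_mem _ hk))
  rcases k with k | k
  · exact if_pos hlt
  · rfl

theorem specializeFrom_x (m k : ℕ) : specializeFrom m (x k) = if k < m then x k else t k :=
  aeval_X _ _

theorem specializeFrom_t (m k : ℕ) : specializeFrom m (t k) = t k :=
  aeval_X _ _

theorem Rplus_specializeFrom_succ (m : ℕ) (f : Poly) :
    Rplus m (specializeFrom (m + 1) f) = specializeFrom (m + 1) f := by
  suffices h : (insertT (m + 1) m).comp (specializeFrom (m + 1)) = specializeFrom (m + 1) from
    DFunLike.congr_fun h f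
  refine Poly.algHom_ext (fun k => ?_) fun k => ?_
  · rw [AlgHom.comp_apply, specializeFrom_x]
    split_ifs with hk
    · rw [insertT_x, if_pos hk]
    · exact insertT_t ..
  · rw [AlgHom.comp_apply, specializeFrom_t, insertT_t]

theorem Rminus_specializeFrom_succ (m : ℕ) (f : Poly) :
    Rminus m (specializeFrom (m + 1) f) = specializeFrom m f := by
  suffices h : (insertT m m).comp (specializeFrom (m + 1)) = specializeFrom m from
    DFunLike.congr_fun h f
  refine Poly.algHom_ext (fun k => ?_) fun k => ?_
  · rw [AlgHom.comp_apply, specializeFrom_x, specializeFrom_x, apply_ite (insertT m m),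
      insertT_x, insertT_t]
    grind
  · rw [AlgHom.comp_apply, specializeFrom_t, specializeFrom_t, insertT_t]

theorem eq_zero_of_Rplus_eq_Rminus {f : Poly} (hf : ∀ i, Rplus i f = Rminus i f)
    (h0 : ev 1 f = 0) : f = 0 := by
  obtain ⟨m, hm⟩ := exists_specializeFrom_eq_self f
  induction m with
  | zero => rw [← hm, specializeFrom_zero, h0, map_zero]
  | succ m ih =>
    refine ih ?_
    rw [← Rminus_specializeFrom_succ, hm, ← hf, ← hm, Rplus_specializeFrom_succ]

theorem IsDividedDifference.Rplus_sub_eq_Rminus_sub {i : ℕ} {f f' g : Poly}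
    (h : IsDividedDifference i f g) (h' : IsDividedDifference i f' g) :
    Rplus i (f - f') = Rminus i (f - f') := by
  rw [← sub_eq_zero, map_sub, map_sub, sub_sub_sub_comm, h, h', sub_self]

namespace IsDoubleForestFamily

variable {P P' : IndexedForest → Poly}

theorem ev_one_eq (hP : IsDoubleForestFamily P) (hP' : IsDoubleForestFamily P')
    (F : IndexedForest) : ev 1 (P F) = ev 1 (P' F) := by
  rcases eq_or_ne F .empty with rfl | hF
  · rw [hP.ev_empty, hP'.ev_empty]
  · rw [hP.ev_of_ne F hF, hP'.ev_of_ne F hF]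

theorem apply_eq (hP : IsDoubleForestFamily P) (hP' : IsDoubleForestFamily P')
    (F : IndexedForest) : P F = P' F := by
  refine sub_eq_zero.1 (eq_zero_of_Rplus_eq_Rminus (fun i => ?_) ?_)
  · by_cases hi : i ∈ F.qdes
    · have : (F.trim i).finsuppCode.degree < F.finsuppCode.degree := by
        rw [F.finsuppCode_trim hi]
        exact Nat.lt_of_succ_le (degree_trimCode (F.qdes_eq_descents ▸ hi)).le
      have h := hP.trim_mem F i hi
      rw [apply_eq hP hP' (F.trim i)] at h
      exact h.Rplus_sub_eq_Rminus_sub (hP'.trim_mem F i hi)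
    · exact (hP.trim_notMem F i hi).Rplus_sub_eq_Rminus_sub (hP'.trim_notMem F i hi)
  · rw [map_sub, hP.ev_one_eq hP', sub_self]
termination_by F.finsuppCode.degree

theorem Rplus_eq_Rminus (hP : IsDoubleForestFamily P) {F : IndexedForest} {i : ℕ}
    (hi : i ∉ F.qdes) : Rplus i (P F) = Rminus i (P F) := by
  have h := hP.trim_notMem F i hi
  rwa [IsDividedDifference, mul_zero, sub_eq_zero] at h

theorem ev_eq_zero (hP : IsDoubleForestFamily P) {n : ℕ} {F : IndexedForest}
    (hF : IsPadded n F.code) (h0 : F.code ≠ 0) {σ : Perm ℕ} (hσ : σ ∈ NC n) :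
    ev σ (P F) = 0 := by
  obtain ⟨k, -, hzero, hpos, -⟩ := hF
  have hqdes : ∀ i, i + 1 < n → i ∉ F.qdes := fun i hi h => by
    obtain ⟨h1, h2⟩ := F.qdes_eq_descents ▸ h
    rcases lt_or_ge i k with hik | hki
    · exact h1.ne' (hzero i hik)
    · exact (hpos (i + 1) (by omega) hi).ne' h2
  rw [ev_eq_of_mem_NC (fun i hi => hP.Rplus_eq_Rminus (hqdes i hi)) hσ, hP.ev_of_ne]
  rintro rfl
  exact h0 (congrArg (⇑) (IndexedForest.finsuppCode_eq_zero_iff.2 rfl))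

end IsDoubleForestFamily

end Uniqueness

end EQSymNC

open EQSymNC in
theorem theorem7p1 :
    (∀ (n : ℕ) (f : Poly) (σ : Equiv.Perm ℕ), f ∈ EQSym n → σ ∈ NC n → ev σ f = ev 1 f) ∧
    (∃! P : IndexedForest → Poly, IsDoubleForestFamily P) ∧
    (∀ P : IndexedForest → Poly, IsDoubleForestFamily P →
      ∀ (n : ℕ) (c : ℕ → ℕ), IsPadded n c → c ≠ 0 →
        ∀ F : IndexedForest, F.code = c → ∀ σ ∈ NC n, ev σ (P F) = 0) ∧
    (∀ n : ℕ, NC n = {σ | Relation.EqvGen (NCStep n) 1 σ}) := by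
  refine ⟨fun n f σ hf hσ => ev_eq_of_mem_NC hf.2 hσ, ?_, ?_, NC_eq_eqvGen⟩
  · exact ⟨_, isDoubleForestFamily_forestPoly,
      fun P hP => funext fun F => hP.apply_eq isDoubleForestFamily_forestPoly F⟩
  · rintro P hP n c hc h0 F rfl σ hσ
    exact hP.ev_eq_zero hc h0 hσ
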